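/- Let $m\ge 1$ be an integer. On the complex Hilbert space $L^2(\mathbb{R})$ consider the operators, both with domain $H^1(\mathbb{R})$, $$L_+ = |\nabla| - \frac{2m}{1+x^2}, \qquad L_- = L_+ + R, \qquad (Rf)(x) = \frac{1}{2\pi}\int_{\mathbb{R}} \frac{|\mathbf{Q}_m(x)-\mathbf{Q}_m(y)|^2}{|x-y|^2}\, f(y)\,dy,$$ where $|\nabla|$ is the Fourier multiplier with symbol $|\xi|$ (for the Fourier transform with kernel $e^{-ix\xi}$) and $\mathbf{Q}_m=(f_m,g_m,0):\mathbb{R}\to\mathbb{S}^2$ is the pure-power half-harmonic map of degree $m$, that is, $$f_m(x)=\mathrm{Re}\Big(i\,\frac{x-i}{x+i}\Big)^m,\qquad g_m(x)=\mathrm{Im}\Big(i\,\frac{x-i}{x+i}\Big)^m .$$ Write $\sigma_{\mathrm p}(T)$ for the set of eigenvalues of $T$ (with eigenfunctions in $H^1(\mathbb{R})$). Then the following hold. (i) $\sigma_{\mathrm p}(L_+)$ consists of exactly $2m$ eigenvalues $E_0,\dots,E_{2m-1}$; each of them is simple (its eigenspace has dimension $1$), and $E_0<E_1<\dots<E_{2m-2}<E_{2m-1}=0$.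 (ii) $\sigma_{\mathrm p}(L_-)=\{0\}$, and the eigenvalue $0$ is exactly $2m$-fold degenerate (its eigenspace has dimension $2m$). In particular, both operators have no embedded eigenvalue $E>0$ inside $\sigma_{\mathrm{ess}}(L_+)=\sigma_{\mathrm{ess}}(L_-)=[0,\infty)$. -/

import Mathlib

open MeasureTheory FourierTransform Filter Topology
open scoped SchwartzMap ENNReal

noncomputable section

namespace HalfWave

/-! ### Point spectrum and essential spectrum of an unbounded operator -/

section Spectrum

variable {H : Type*} [NormedAddCommGroup H] [InnerProductSpace ℂ H]

/-- The set of eigenvalues of an unbounded operator `T`; eigenvectors lie in the domain of `T`. -/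
def pointSpectrum (T : H →ₗ.[ℂ] H) : Set ℂ :=
  {z | ∃ u : T.domain, u ≠ 0 ∧ T u = z • (u : H)}

/-- The eigenspace `{u ∈ dom T : T u = z u}`. -/
def eigenspace (T : H →ₗ.[ℂ] H) (z : ℂ) : Submodule ℂ T.domain :=
  LinearMap.ker (T.toFun - z • T.domain.subtype)

/-- The essential spectrum of a (self-adjoint) operator, through singular Weyl sequences:
normalized sequences `u n ∈ dom T` with `u n ⇀ 0` weakly and `(T - z) u n → 0` in norm. -/
def essentialSpectrum (T : H →ₗ.[ℂ] H) : Set ℂ :=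
  {z | ∃ u : ℕ → T.domain, (∀ n, ‖(u n : H)‖ = 1) ∧
    (∀ v : H, Tendsto (fun n => inner ℂ v (u n : H)) atTop (𝓝 0)) ∧
    Tendsto (fun n => T (u n) - z • (u n : H)) atTop (𝓝 0)}

end Spectrum

/-- The complex Hilbert space `L²(ℝ)`. -/
abbrev L2 : Type := Lp ℂ 2 (volume : Measure ℝ)

/-! ### The Sobolev space `H¹(ℝ)` and the operator `|∇|` -/

/-- The Sobolev space `H¹(ℝ)` as a subspace of `L²(ℝ)`. -/
def H1 : Submodule ℂ L2 where
  carrier := {f | TemperedDistribution.MemSobolev 1 2 (f : 𝓢'(ℝ, ℂ))}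
  add_mem' {f g} hf hg := by
    have h := TemperedDistribution.MemSobolev.add hf hg
    rw [← Lp.toTemperedDistributionCLM_apply, ← Lp.toTemperedDistributionCLM_apply,
      ← map_add] at h
    exact h
  zero_mem' := by
    have h := TemperedDistribution.memSobolev_fun_zero ℝ ℂ 1 2
    rw [← map_zero (Lp.toTemperedDistributionCLM ℂ (volume : Measure ℝ) 2)] at h
    exact h
  smul_mem' c f hf := by
    have h := TemperedDistribution.MemSobolev.smul c hf
    rw [← Lp.toTemperedDistributionCLM_apply, ← map_smul] at h
    exact h

/-- The symbol of `|∇|` for the Fourier transform `𝓕 f ξ = ∫ exp (-2πixξ) f x dx`. -/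
def absSymbol (ξ : ℝ) : ℂ := ((2 * Real.pi * |ξ| : ℝ) : ℂ)

theorem memLp_absSymbol_mul {f : L2} (hf : f ∈ H1) :
    MemLp (fun ξ => absSymbol ξ * (𝓕 f : L2) ξ) 2 (volume : Measure ℝ) := by
  obtain ⟨u, hu⟩ := TemperedDistribution.memSobolev_iff_exists_smulLeftCLM_fourier.mp hf
  -- `b = (1 + ξ²)^(-1/2)` is bounded, and the Fourier transform of `f` is `b u`
  have hbm : MemLp (fun ξ : ℝ => (((1 + ‖ξ‖ ^ 2) ^ (-1 / 2 : ℝ) : ℝ) : ℂ)) ∞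
      (volume : Measure ℝ) := by
    refine memLp_top_of_bound ?_ 1 (Eventually.of_forall fun ξ => ?_)
    · refine Continuous.aestronglyMeasurable ?_
      refine Complex.continuous_ofReal.comp ?_
      exact Continuous.rpow_const (by fun_prop) fun ξ => Or.inl (by positivity)
    · rw [Complex.norm_real, Real.norm_of_nonneg (by positivity)]
      exact Real.rpow_le_one_of_one_le_of_nonpos (le_add_of_nonneg_right (by positivity))
        (by norm_num)
  have key : (𝓕 f : L2) = hbm.toLp • u := by
    have hinj := LinearMap.ker_eq_bot.mp
      (Lp.ker_toTemperedDistributionCLM_eq_bot (F := ℂ) (E := ℝ) (p := 2)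
        (μ := (volume : Measure ℝ)))
    apply hinj
    change Lp.toTemperedDistributionCLM ℂ volume 2 _ = Lp.toTemperedDistributionCLM ℂ volume 2 _
    rw [Lp.toTemperedDistributionCLM_apply, Lp.toTemperedDistributionCLM_apply,
      Lp.toTemperedDistribution_smul_eq (by fun_prop), ← hu,
      TemperedDistribution.smulLeftCLM_smulLeftCLM_apply (by fun_prop) (by fun_prop),
      Lp.fourier_toTemperedDistribution_eq]
    symm
    convert TemperedDistribution.smulLeftCLM_const (1 : ℂ) ((𝓕 f : L2) : 𝓢'(ℝ, ℂ)) using 1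
    · congr 2
      ext ξ
      rw [Pi.mul_apply, ← Complex.ofReal_mul, ← Real.rpow_add (by positivity)]
      norm_num
    · simp
  refine MemLp.of_le_mul (c := 2 * Real.pi) (Lp.memLp u) ?_ ?_
  · refine AEStronglyMeasurable.mul ?_ (Lp.aestronglyMeasurable _)
    refine Continuous.aestronglyMeasurable ?_
    unfold absSymbol
    fun_prop
  · have h1 : ((𝓕 f : L2) : ℝ → ℂ) =ᵐ[volume] ((hbm.toLp • u : L2) : ℝ → ℂ) := by rw [key]
    filter_upwards [h1, Lp.coeFn_lpSMul (r := 2) hbm.toLp u, hbm.coeFn_toLp] with ξ e1 e2 e3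
    rw [e1, e2, Pi.smul_apply', e3, smul_eq_mul, norm_mul, norm_mul, absSymbol,
      Complex.norm_real, Complex.norm_real, Real.norm_of_nonneg (by positivity),
      Real.norm_of_nonneg (by positivity), ← mul_assoc, mul_assoc (2 * Real.pi)]
    refine mul_le_mul_of_nonneg_right ?_ (norm_nonneg _)
    refine mul_le_of_le_one_right (by positivity) ?_
    have h2 : |ξ| ≤ (1 + ‖ξ‖ ^ 2) ^ (1 / 2 : ℝ) := by
      rw [← Real.sqrt_eq_rpow]
      refine Real.le_sqrt_of_sq_le ?_
      rw [Real.norm_eq_abs]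
      linarith
    calc |ξ| * (1 + ‖ξ‖ ^ 2) ^ (-1 / 2 : ℝ)
        ≤ (1 + ‖ξ‖ ^ 2) ^ (1 / 2 : ℝ) * (1 + ‖ξ‖ ^ 2) ^ (-1 / 2 : ℝ) :=
          mul_le_mul_of_nonneg_right h2 (by positivity)
      _ = 1 := by
          rw [← Real.rpow_add (by positivity)]
          norm_num

/-- `|∇| : H¹(ℝ) → L²(ℝ)`, the Fourier multiplier with symbol `2π|ξ|`. -/
def absNabla : H1 →ₗ[ℂ] L2 where
  toFun f := 𝓕⁻ ((memLp_absSymbol_mul f.2).toLp _ : L2)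
  map_add' f g := by
    rw [← FourierTransform.fourierInv_add]
    congr 1
    apply Lp.ext
    have h : ((𝓕 ((f + g : H1) : L2) : L2) : ℝ → ℂ) =ᵐ[volume]
        ((𝓕 (f : L2) + 𝓕 (g : L2) : L2) : ℝ → ℂ) := by
      rw [Submodule.coe_add, FourierTransform.fourier_add]
    filter_upwards [h, (memLp_absSymbol_mul (f + g).2).coeFn_toLp,
      (memLp_absSymbol_mul f.2).coeFn_toLp, (memLp_absSymbol_mul g.2).coeFn_toLp,
      Lp.coeFn_add ((memLp_absSymbol_mul f.2).toLp _) ((memLp_absSymbol_mul g.2).toLp _),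
      Lp.coeFn_add (𝓕 (f : L2) : L2) (𝓕 (g : L2) : L2)] with ξ h1 h2 h3 h4 h5 h6
    rw [h2, h1, h5, h6, Pi.add_apply, Pi.add_apply, h3, h4, mul_add]
  map_smul' c f := by
    rw [RingHom.id_apply, ← FourierTransform.fourierInv_smul]
    congr 1
    apply Lp.ext
    have h : ((𝓕 ((c • f : H1) : L2) : L2) : ℝ → ℂ) =ᵐ[volume]
        ((c • 𝓕 (f : L2) : L2) : ℝ → ℂ) := by
      rw [Submodule.coe_smul, FourierTransform.fourier_smul]
    filter_upwards [h, (memLp_absSymbol_mul (c • f).2).coeFn_toLp,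
      (memLp_absSymbol_mul f.2).coeFn_toLp,
      Lp.coeFn_smul c ((memLp_absSymbol_mul f.2).toLp _),
      Lp.coeFn_smul c (𝓕 (f : L2) : L2)] with ξ h1 h2 h3 h4 h5
    rw [h2, h1, h4, h5, Pi.smul_apply, Pi.smul_apply, h3, smul_eq_mul, smul_eq_mul]
    ring

/-! ### The potential `2m/(1+x²)` -/

/-- The potential `2m/(1+x²)`. -/
def potential (m : ℕ) (x : ℝ) : ℝ := 2 * m / (1 + x ^ 2)

theorem memLp_potential_mul (m : ℕ) (f : L2) :
    MemLp (fun x => (potential m x : ℂ) * f x) 2 (volume : Measure ℝ) := by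
  refine MemLp.of_le_mul (c := 2 * m) (Lp.memLp f) ?_ (Eventually.of_forall fun x => ?_)
  · refine AEStronglyMeasurable.mul ?_ (Lp.aestronglyMeasurable _)
    refine Measurable.aestronglyMeasurable ?_
    unfold potential
    fun_prop
  · rw [norm_mul, potential, Complex.norm_real, Real.norm_of_nonneg (by positivity)]
    refine mul_le_mul_of_nonneg_right ?_ (norm_nonneg _)
    exact div_le_self (by positivity) (by nlinarith [sq_nonneg x])

/-- Multiplication by `2m/(1+x²)` on `L²(ℝ)`. -/
def potentialOp (m : ℕ) : L2 →ₗ[ℂ] L2 where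
  toFun f := (memLp_potential_mul m f).toLp _
  map_add' f g := by
    apply Lp.ext
    filter_upwards [(memLp_potential_mul m (f + g)).coeFn_toLp,
      (memLp_potential_mul m f).coeFn_toLp, (memLp_potential_mul m g).coeFn_toLp,
      Lp.coeFn_add ((memLp_potential_mul m f).toLp _) ((memLp_potential_mul m g).toLp _),
      Lp.coeFn_add f g] with x h1 h2 h3 h4 h5
    rw [h1, h4, h5, Pi.add_apply, Pi.add_apply, h2, h3, mul_add]
  map_smul' c f := by
    apply Lp.ext
    filter_upwards [(memLp_potential_mul m (c • f)).coeFn_toLp,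
      (memLp_potential_mul m f).coeFn_toLp,
      Lp.coeFn_smul c ((memLp_potential_mul m f).toLp _),
      Lp.coeFn_smul c f] with x h1 h2 h3 h4
    rw [RingHom.id_apply, h1, h3, h4, Pi.smul_apply, Pi.smul_apply, h2, smul_eq_mul, smul_eq_mul]
    ring

/-! ### The half-harmonic map `Q_m` and the integral operator `R` -/

/-- `f_k(x) = Re (i (x - i)/(x + i))^k`. -/
def fFun (k : ℕ) (x : ℝ) : ℝ :=
  ((Complex.I * (((x : ℂ) - Complex.I) / ((x : ℂ) + Complex.I))) ^ k).re

/-- `g_k(x) = Im (i (x - i)/(x + i))^k`. -/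
def gFun (k : ℕ) (x : ℝ) : ℝ :=
  ((Complex.I * (((x : ℂ) - Complex.I) / ((x : ℂ) + Complex.I))) ^ k).im

/-- The pure-power half-harmonic map `Q_m = (f_m, g_m, 0)` of degree `m`. -/
def Q (m : ℕ) (x : ℝ) : EuclideanSpace ℝ (Fin 3) := !₂[fFun m x, gFun m x, 0]

/-- The integral kernel `(1/2π) |Q_m(x) - Q_m(y)|² / |x - y|²`. -/
def kernelR (m : ℕ) (x y : ℝ) : ℝ :=
  1 / (2 * Real.pi) * (‖Q m x - Q m y‖ ^ 2 / |x - y| ^ 2)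

theorem kernelR_eq (m : ℕ) (x y : ℝ) :
    kernelR m x y = 1 / (2 * Real.pi) *
      (‖(Complex.I * (((x : ℂ) - Complex.I) / ((x : ℂ) + Complex.I))) ^ m -
        (Complex.I * (((y : ℂ) - Complex.I) / ((y : ℂ) + Complex.I))) ^ m‖ ^ 2 / |x - y| ^ 2) := by
  rw [kernelR, EuclideanSpace.norm_sq_eq, Complex.sq_norm, Complex.normSq_apply, Fin.sum_univ_three]
  simp [Q, fFun, gFun, pow_two]

theorem measurable_kernelR (m : ℕ) : Measurable fun p : ℝ × ℝ => kernelR m p.1 p.2 := by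
  simp only [kernelR_eq]
  fun_prop

theorem norm_sub_I_sq (x : ℝ) : ‖(x : ℂ) - Complex.I‖ ^ 2 = 1 + x ^ 2 := by
  rw [Complex.sq_norm, Complex.normSq_apply]
  simp
  ring

theorem norm_add_I_sq (x : ℝ) : ‖(x : ℂ) + Complex.I‖ ^ 2 = 1 + x ^ 2 := by
  rw [Complex.sq_norm, Complex.normSq_apply]
  simp
  ring

theorem add_I_ne_zero (x : ℝ) : (x : ℂ) + Complex.I ≠ 0 := by
  intro h
  have h1 := norm_add_I_sq x
  rw [h, norm_zero] at h1
  nlinarith [sq_nonneg x]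

theorem norm_cayley (x : ℝ) :
    ‖Complex.I * (((x : ℂ) - Complex.I) / ((x : ℂ) + Complex.I))‖ = 1 := by
  have h1 : ‖Complex.I * (((x : ℂ) - Complex.I) / ((x : ℂ) + Complex.I))‖ ^ 2 = 1 := by
    rw [norm_mul, norm_div, Complex.norm_I, one_mul, div_pow, norm_sub_I_sq, norm_add_I_sq]
    exact div_self (by positivity)
  exact (pow_eq_one_iff_of_nonneg (norm_nonneg _) two_ne_zero).mp h1

theorem norm_cayley_sub_sq (x y : ℝ) :
    ‖Complex.I * (((x : ℂ) - Complex.I) / ((x : ℂ) + Complex.I)) -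
      Complex.I * (((y : ℂ) - Complex.I) / ((y : ℂ) + Complex.I))‖ ^ 2 =
      4 * |x - y| ^ 2 * ((1 + x ^ 2)⁻¹ * (1 + y ^ 2)⁻¹) := by
  have hx := add_I_ne_zero x
  have hy := add_I_ne_zero y
  have h : Complex.I * (((x : ℂ) - Complex.I) / ((x : ℂ) + Complex.I)) -
      Complex.I * (((y : ℂ) - Complex.I) / ((y : ℂ) + Complex.I)) =
      (-2 * ((x - y : ℝ) : ℂ)) / (((x : ℂ) + Complex.I) * ((y : ℂ) + Complex.I)) := by
    field_simp
    push_cast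
    linear_combination (2 * ((x : ℂ) - y)) * Complex.I_sq
  rw [h, norm_div, norm_mul, norm_mul, div_pow, mul_pow, mul_pow, norm_add_I_sq, norm_add_I_sq,
    Complex.norm_real, Real.norm_eq_abs, div_eq_mul_inv, mul_inv]
  norm_num

theorem norm_pow_sub_pow_le {a b : ℂ} (ha : ‖a‖ = 1) (hb : ‖b‖ = 1) (m : ℕ) :
    ‖a ^ m - b ^ m‖ ≤ m * ‖a - b‖ := by
  induction m with
  | zero => simp
  | succ k ih =>
    have h : a ^ (k + 1) - b ^ (k + 1) = a ^ k * (a - b) + (a ^ k - b ^ k) * b := by ring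
    calc ‖a ^ (k + 1) - b ^ (k + 1)‖ ≤ ‖a ^ k * (a - b)‖ + ‖(a ^ k - b ^ k) * b‖ := by
          rw [h]; exact norm_add_le _ _
      _ = ‖a - b‖ + ‖a ^ k - b ^ k‖ := by
          rw [norm_mul, norm_mul, norm_pow, ha, hb, one_pow, one_mul, mul_one]
      _ ≤ ‖a - b‖ + k * ‖a - b‖ := by gcongr
      _ = ((k + 1 : ℕ) : ℝ) * ‖a - b‖ := by push_cast; ring

theorem kernelR_nonneg (m : ℕ) (x y : ℝ) : 0 ≤ kernelR m x y := by
  unfold kernelR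
  positivity

theorem kernelR_le (m : ℕ) (x y : ℝ) :
    kernelR m x y ≤ 2 * m ^ 2 / Real.pi * ((1 + x ^ 2)⁻¹ * (1 + y ^ 2)⁻¹) := by
  rcases eq_or_ne x y with rfl | hxy
  · have h : kernelR m x x = 0 := by simp [kernelR]
    rw [h]
    positivity
  have hpos : 0 < |x - y| ^ 2 := by
    have := abs_pos.mpr (sub_ne_zero.mpr hxy)
    positivity
  rw [kernelR_eq]
  have h1 := pow_le_pow_left₀ (norm_nonneg _)
    (norm_pow_sub_pow_le (norm_cayley x) (norm_cayley y) m) 2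
  rw [mul_pow (m : ℝ), norm_cayley_sub_sq] at h1
  calc _ ≤ 1 / (2 * Real.pi) *
        ((m : ℝ) ^ 2 * (4 * |x - y| ^ 2 * ((1 + x ^ 2)⁻¹ * (1 + y ^ 2)⁻¹)) / |x - y| ^ 2) := by
        gcongr
    _ = _ := by
        have := Real.pi_pos
        field_simp
        ring

theorem memLp_inv_one_add_sq : MemLp (fun x : ℝ => (1 + x ^ 2)⁻¹) 2 (volume : Measure ℝ) := by
  have hm : AEStronglyMeasurable (fun x : ℝ => (1 + x ^ 2)⁻¹) (volume : Measure ℝ) :=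
    Measurable.aestronglyMeasurable (by fun_prop)
  rw [memLp_two_iff_integrable_sq hm]
  refine Integrable.mono' integrable_inv_one_add_sq (hm.pow 2) (Eventually.of_forall fun x => ?_)
  have h1 : (1 + x ^ 2)⁻¹ ≤ 1 := inv_le_one_of_one_le₀ (by nlinarith [sq_nonneg x])
  have h0 : 0 ≤ (1 + x ^ 2)⁻¹ := by positivity
  rw [Real.norm_of_nonneg (by positivity)]
  nlinarith

theorem integrable_weight_mul (f : L2) :
    Integrable (fun y => (1 + y ^ 2)⁻¹ * ‖f y‖) (volume : Measure ℝ) :=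
  memLp_inv_one_add_sq.integrable_mul (Lp.memLp f).norm

theorem norm_kernelR_mul_le (m : ℕ) (f : L2) (x y : ℝ) :
    ‖(kernelR m x y : ℂ) * f y‖ ≤
      2 * m ^ 2 / Real.pi * (1 + x ^ 2)⁻¹ * ((1 + y ^ 2)⁻¹ * ‖f y‖) := by
  rw [norm_mul, Complex.norm_real, Real.norm_of_nonneg (kernelR_nonneg m x y)]
  calc _ ≤ 2 * m ^ 2 / Real.pi * ((1 + x ^ 2)⁻¹ * (1 + y ^ 2)⁻¹) * ‖f y‖ :=
        mul_le_mul_of_nonneg_right (kernelR_le m x y) (norm_nonneg _)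
    _ = _ := by ring

theorem integrable_kernelR (m : ℕ) (f : L2) (x : ℝ) :
    Integrable (fun y => (kernelR m x y : ℂ) * f y) (volume : Measure ℝ) := by
  refine Integrable.mono' ((integrable_weight_mul f).const_mul
    (2 * m ^ 2 / Real.pi * (1 + x ^ 2)⁻¹)) ?_
    (Eventually.of_forall fun y => norm_kernelR_mul_le m f x y)
  refine AEStronglyMeasurable.mul ?_ (Lp.aestronglyMeasurable _)
  exact (Complex.measurable_ofReal.comp
    ((measurable_kernelR m).comp measurable_prodMk_left)).aestronglyMeasurable

theorem memLp_kernelR (m : ℕ) (f : L2) :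
    MemLp (fun x => ∫ y, (kernelR m x y : ℂ) * f y) 2 (volume : Measure ℝ) := by
  refine MemLp.of_le_mul (c := 2 * m ^ 2 / Real.pi * ∫ y, (1 + y ^ 2)⁻¹ * ‖f y‖)
    memLp_inv_one_add_sq ?_ (Eventually.of_forall fun x => ?_)
  · refine AEStronglyMeasurable.integral_prod_right'
      (f := fun p : ℝ × ℝ => (kernelR m p.1 p.2 : ℂ) * f p.2) ?_
    refine AEStronglyMeasurable.mul ?_ ?_
    · exact (Complex.measurable_ofReal.comp (measurable_kernelR m)).aestronglyMeasurable
    · exact (Lp.aestronglyMeasurable f).comp_snd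
  · calc ‖∫ y, (kernelR m x y : ℂ) * f y‖
        ≤ ∫ y, 2 * m ^ 2 / Real.pi * (1 + x ^ 2)⁻¹ * ((1 + y ^ 2)⁻¹ * ‖f y‖) :=
          norm_integral_le_of_norm_le ((integrable_weight_mul f).const_mul _)
            (Eventually.of_forall fun y => norm_kernelR_mul_le m f x y)
      _ = _ := by
          rw [integral_const_mul, Real.norm_of_nonneg (by positivity)]
          ring

/-- The integral operator `(R f)(x) = (1/2π) ∫ |Q_m(x) - Q_m(y)|² / |x - y|² f(y) dy`. -/
def opR (m : ℕ) : L2 →ₗ[ℂ] L2 where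
  toFun f := (memLp_kernelR m f).toLp _
  map_add' f g := by
    apply Lp.ext
    filter_upwards [(memLp_kernelR m (f + g)).coeFn_toLp,
      (memLp_kernelR m f).coeFn_toLp, (memLp_kernelR m g).coeFn_toLp,
      Lp.coeFn_add ((memLp_kernelR m f).toLp _) ((memLp_kernelR m g).toLp _)] with x h1 h2 h3 h4
    rw [h1, h4, Pi.add_apply, h2, h3,
      ← integral_add (integrable_kernelR m f x) (integrable_kernelR m g x)]
    refine integral_congr_ae ?_
    filter_upwards [Lp.coeFn_add f g] with y hy
    rw [hy, Pi.add_apply, mul_add]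
  map_smul' c f := by
    apply Lp.ext
    filter_upwards [(memLp_kernelR m (c • f)).coeFn_toLp, (memLp_kernelR m f).coeFn_toLp,
      Lp.coeFn_smul c ((memLp_kernelR m f).toLp _)] with x h1 h2 h3
    rw [RingHom.id_apply, h1, h3, Pi.smul_apply, h2, smul_eq_mul, ← integral_const_mul]
    refine integral_congr_ae ?_
    filter_upwards [Lp.coeFn_smul c f] with y hy
    rw [hy, Pi.smul_apply, smul_eq_mul]
    ring

/-! ### The operators `L₊` and `L₋` -/

/-- `L₊ = |∇| - 2m/(1+x²)` on `L²(ℝ)` with domain `H¹(ℝ)`. -/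
def Lplus (m : ℕ) : L2 →ₗ.[ℂ] L2 where
  domain := H1
  toFun := absNabla - potentialOp m ∘ₗ H1.subtype

/-- `L₋ = L₊ + R` on `L²(ℝ)` with domain `H¹(ℝ)`. -/
def Lminus (m : ℕ) : L2 →ₗ.[ℂ] L2 where
  domain := (Lplus m).domain
  toFun := (Lplus m).toFun + opR m ∘ₗ (Lplus m).domain.subtype

end HalfWave

end

noncomputable section

namespace HalfWave

open scoped BoundedContinuousFunction ComplexConjugate

/-! ### The Fourier transform of integrable square integrable functions -/

/-! Write c(x) = (x - i)/(x + i), D = -i d/dx, and e_n = c^n/(x + i) (`ratBasis n`). The e_n are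
orthogonal; those with n ≥ 0 lie in the Hardy space H₊ of nonnegative frequencies, those with n < 0
in H₋.

Multiplication by c^m absorbs the potential. Since D c^m = 2m/(1+x²) c^m and |∇| = ±D on H₊ and H₋,
one gets L₊(c^m f) = c^m D f for f in H₊ and L₊(c^{-m} f) = -c^{-m} D f for f in H₋
(`lplus_cayleyMul`, `lplus_cayleyMul_neg`). D has no eigenvectors, so by symmetry an eigenfunction
of L₊ is orthogonal to c^m H₊ and to c^{-m} H₋ (`mem_hardy_of_forall_inner`,
`mem_ratSpan_of_eigenvector`). It therefore lies in c^m H₋ ∩ c^{-m} H₊, which is the 2m-dimensional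
span V of e_{-m}, ..., e_{m-1} (`mem_ratSpan_of_hardy`).

The kernel of R is a finite sum of rank-one kernels built from c^d/(1+x²), |d| < m
(`kernelR_eq_sum`, `opR_eq_sum`). Hence R vanishes on c^m H₊ and c^{-m} H₋, and eigenfunctions of L₋
lie in V too. On V both operators are explicit: L₊ is half the Laplacian of a path whose edge from n
- 1 to n has weight m - |n|, and R is its negative (`lplus_ratBasis`, `opR_ratBasis`). So L₋ = 0 on
V, which settles L₋. For L₊ = -R on V, a Jacobi matrix with nonzero off-diagonal entries has simple
eigenvalues (`eq_zero_of_inner_eq_zero`), R ≥ 0 makes them nonpositive, and the sum of all e_n in V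
spans the kernel. This gives 2m distinct eigenvalues with largest one 0.

The essential spectrum is that of |∇|, by Weyl sequences: R has finite rank, and the potential is
compact relative to |∇| (`tendsto_weightMul`). -/

theorem fourier_coeFn_ae_eq {g : L2} (hg : Integrable (g : ℝ → ℂ) (volume : Measure ℝ)) :
    ((𝓕 g : L2) : ℝ → ℂ) =ᵐ[volume] 𝓕 (g : ℝ → ℂ) := by
  have hcont : Continuous (𝓕 (g : ℝ → ℂ)) :=
    VectorFourier.fourierIntegral_continuous Real.continuous_fourierChar
      (by exact continuous_inner) hg
  refine ae_eq_of_integral_contDiff_smul_eq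
    ((Lp.memLp (𝓕 g : L2)).locallyIntegrable (by norm_num)) hcont.locallyIntegrable ?_
  intro φ φ_smooth φ_cpt
  have h₁ : HasCompactSupport (Complex.ofRealCLM ∘ φ) := φ_cpt.comp_left rfl
  have h₂ : ContDiff ℝ (⊤ : ℕ∞) (Complex.ofRealCLM ∘ φ) := by fun_prop
  set ψ : 𝓢(ℝ, ℂ) := h₁.toSchwartzMap h₂ with hψ
  have h3 : ((𝓕 g : L2) : 𝓢'(ℝ, ℂ)) ψ = ∫ x, φ x • (𝓕 g : L2) x := by
    simp [hψ]
  rw [← h3, ← Lp.fourier_toTemperedDistribution_eq, TemperedDistribution.fourier_apply,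
    Lp.toTemperedDistribution_apply]
  -- Fubini moves the Fourier integral from the test function to `g`.
  have h4 := VectorFourier.integral_fourierIntegral_smul_eq_flip (L := innerₗ ℝ)
    (μ := (volume : Measure ℝ)) (ν := (volume : Measure ℝ))
    Real.continuous_fourierChar continuous_inner (ψ.integrable (μ := volume)) hg
  have h5 : ∫ x, φ x • 𝓕 (g : ℝ → ℂ) x = ∫ x, ψ x • 𝓕 (g : ℝ → ℂ) x := by
    simp [hψ]
  rw [h5, SchwartzMap.fourier_coe]
  simpa using! h4

theorem fourierInv_coeFn_ae_eq {g : L2} (hg : Integrable (g : ℝ → ℂ) (volume : Measure ℝ)) :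
    ((𝓕⁻ g : L2) : ℝ → ℂ) =ᵐ[volume] 𝓕⁻ (g : ℝ → ℂ) := by
  have hcont : Continuous (𝓕⁻ (g : ℝ → ℂ)) :=
    VectorFourier.fourierIntegral_continuous Real.continuous_fourierChar
      (L := -innerₗ ℝ) (by exact continuous_inner.neg) hg
  refine ae_eq_of_integral_contDiff_smul_eq
    ((Lp.memLp (𝓕⁻ g : L2)).locallyIntegrable (by norm_num)) hcont.locallyIntegrable ?_
  intro φ φ_smooth φ_cpt
  have h₁ : HasCompactSupport (Complex.ofRealCLM ∘ φ) := φ_cpt.comp_left rfl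
  have h₂ : ContDiff ℝ (⊤ : ℕ∞) (Complex.ofRealCLM ∘ φ) := by fun_prop
  set ψ : 𝓢(ℝ, ℂ) := h₁.toSchwartzMap h₂ with hψ
  have h3 : ((𝓕⁻ g : L2) : 𝓢'(ℝ, ℂ)) ψ = ∫ x, φ x • (𝓕⁻ g : L2) x := by
    simp [hψ]
  rw [← h3, ← Lp.fourierInv_toTemperedDistribution_eq, TemperedDistribution.fourierInv_apply,
    Lp.toTemperedDistribution_apply]
  have h4 := VectorFourier.integral_fourierIntegral_smul_eq_flip (L := -innerₗ ℝ)
    (μ := (volume : Measure ℝ)) (ν := (volume : Measure ℝ))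
    Real.continuous_fourierChar continuous_inner.neg (ψ.integrable (μ := volume)) hg
  have h5 : ∫ x, φ x • 𝓕⁻ (g : ℝ → ℂ) x = ∫ x, ψ x • 𝓕⁻ (g : ℝ → ℂ) x := by
    simp [hψ]
  have h6 : (-innerₗ ℝ).flip = -innerₗ ℝ := by
    ext
    simp
  rw [h6] at h4
  rw [h5, SchwartzMap.fourierInv_coe]
  exact h4

/-! ### Multiplication operators -/

theorem memLp_bcf_mul (q : ℝ →ᵇ ℂ) (f : L2) :
    MemLp (fun x => q x * f x) 2 (volume : Measure ℝ) := by
  refine MemLp.of_le_mul (c := ‖q‖) (Lp.memLp f) ?_ (Eventually.of_forall fun x => ?_)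
  · exact q.continuous.aestronglyMeasurable.mul (Lp.aestronglyMeasurable _)
  · rw [norm_mul]
    exact mul_le_mul_of_nonneg_right (q.norm_coe_le_norm x) (norm_nonneg _)

/-- Multiplication by a bounded continuous function on `L²(ℝ)`. -/
def mulL2 (q : ℝ →ᵇ ℂ) : L2 →L[ℂ] L2 :=
  LinearMap.mkContinuous
    { toFun := fun f => (memLp_bcf_mul q f).toLp _
      map_add' := fun f g => by
        apply Lp.ext
        filter_upwards [(memLp_bcf_mul q (f + g)).coeFn_toLp, (memLp_bcf_mul q f).coeFn_toLp,
          (memLp_bcf_mul q g).coeFn_toLp,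
          Lp.coeFn_add ((memLp_bcf_mul q f).toLp _) ((memLp_bcf_mul q g).toLp _),
          Lp.coeFn_add f g] with x h1 h2 h3 h4 h5
        rw [h1, h4, h5, Pi.add_apply, Pi.add_apply, h2, h3, mul_add]
      map_smul' := fun c f => by
        apply Lp.ext
        filter_upwards [(memLp_bcf_mul q (c • f)).coeFn_toLp, (memLp_bcf_mul q f).coeFn_toLp,
          Lp.coeFn_smul c ((memLp_bcf_mul q f).toLp _), Lp.coeFn_smul c f] with x h1 h2 h3 h4
        rw [RingHom.id_apply, h1, h3, h4, Pi.smul_apply, Pi.smul_apply, h2, smul_eq_mul,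
          smul_eq_mul]
        ring }
    ‖q‖ (fun f => by
      refine Lp.norm_le_mul_norm_of_ae_le_mul ?_
      filter_upwards [(memLp_bcf_mul q f).coeFn_toLp] with x hx
      change ‖(memLp_bcf_mul q f).toLp _ x‖ ≤ _
      rw [hx, norm_mul]
      exact mul_le_mul_of_nonneg_right (q.norm_coe_le_norm x) (norm_nonneg _))

theorem coeFn_mulL2 (q : ℝ →ᵇ ℂ) (f : L2) : mulL2 q f =ᵐ[volume] fun x => q x * f x :=
  (memLp_bcf_mul q f).coeFn_toLp

theorem mulL2_one (f : L2) : mulL2 1 f = f := by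
  apply Lp.ext
  filter_upwards [coeFn_mulL2 1 f] with x h
  simp [h]

theorem mulL2_mul (p q : ℝ →ᵇ ℂ) (f : L2) : mulL2 (p * q) f = mulL2 p (mulL2 q f) := by
  apply Lp.ext
  filter_upwards [coeFn_mulL2 (p * q) f, coeFn_mulL2 q f, coeFn_mulL2 p (mulL2 q f)] with x h1 h2 h3
  rw [h1, h3, h2, BoundedContinuousFunction.mul_apply, mul_assoc]

theorem mulL2_add (p q : ℝ →ᵇ ℂ) (f : L2) : mulL2 (p + q) f = mulL2 p f + mulL2 q f := by
  apply Lp.ext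
  filter_upwards [coeFn_mulL2 (p + q) f, coeFn_mulL2 q f, coeFn_mulL2 p f,
    Lp.coeFn_add (mulL2 p f) (mulL2 q f)] with x h1 h2 h3 h4
  rw [h1, h4, Pi.add_apply, h3, h2, BoundedContinuousFunction.add_apply, add_mul]

theorem mulL2_smul (c : ℂ) (q : ℝ →ᵇ ℂ) (f : L2) : mulL2 (c • q) f = c • mulL2 q f := by
  apply Lp.ext
  filter_upwards [coeFn_mulL2 (c • q) f, coeFn_mulL2 q f,
    Lp.coeFn_smul c (mulL2 q f)] with x h1 h2 h4
  rw [h1, h4, Pi.smul_apply, h2, BoundedContinuousFunction.smul_apply, smul_eq_mul, smul_eq_mul,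
    mul_assoc]

theorem mulL2_sub (p q : ℝ →ᵇ ℂ) (f : L2) : mulL2 (p - q) f = mulL2 p f - mulL2 q f := by
  have h : p - q = p + (-1 : ℂ) • q := by simp [sub_eq_add_neg]
  rw [h, mulL2_add, mulL2_smul]
  simp [sub_eq_add_neg]

theorem inner_mulL2_left (q : ℝ →ᵇ ℂ) (f g : L2) :
    inner ℂ (mulL2 q f) g = inner ℂ f (mulL2 (star q) g) := by
  rw [L2.inner_def, L2.inner_def]
  refine integral_congr_ae ?_
  filter_upwards [coeFn_mulL2 q f, coeFn_mulL2 (star q) g] with x h1 h2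
  simp only [h1, h2, RCLike.inner_apply, map_mul, BoundedContinuousFunction.star_apply,
    RCLike.star_def]
  ring

/-! ### Products and convolutions -/

/-- The bounded continuous function `q` is the inverse Fourier transform of `κ ∈ L¹ ∩ L²`. -/
structure IsFourierPair (κ : ℝ → ℂ) (q : ℝ →ᵇ ℂ) : Prop where
  integrable : Integrable κ (volume : Measure ℝ)
  memLp : MemLp κ 2 (volume : Measure ℝ)
  eq_fourierInv : ∀ x, q x = 𝓕⁻ κ x

namespace IsFourierPair

variable {κ : ℝ → ℂ} {q : ℝ →ᵇ ℂ}

/-- The test function whose pairing with `𝓕 f` gives the convolution at `ξ`. -/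
theorem memLp_reflect (h : IsFourierPair κ q) (ξ : ℝ) :
    MemLp (fun η => conj (κ (ξ - η))) 2 (volume : Measure ℝ) :=
  (h.memLp.comp_measurePreserving (Measure.measurePreserving_sub_left volume ξ)).star

theorem integrable_reflect (h : IsFourierPair κ q) (ξ : ℝ) :
    Integrable (fun η => conj (κ (ξ - η))) (volume : Measure ℝ) :=
  (memLp_one_iff_integrable.1 (((memLp_one_iff_integrable.2 h.integrable).comp_measurePreserving
    (Measure.measurePreserving_sub_left volume ξ)).star))

theorem coeFn_fourierInv_toLp (h : IsFourierPair κ q) :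
    ((𝓕⁻ (h.memLp.toLp κ) : L2) : ℝ → ℂ) =ᵐ[volume] q := by
  have h1 : Integrable (h.memLp.toLp κ : ℝ → ℂ) (volume : Measure ℝ) :=
    h.integrable.congr h.memLp.coeFn_toLp.symm
  filter_upwards [fourierInv_coeFn_ae_eq h1] with x hx
  rw [hx, h.eq_fourierInv, Real.fourierInv_eq, Real.fourierInv_eq]
  refine integral_congr_ae ?_
  filter_upwards [h.memLp.coeFn_toLp] with y hy
  rw [hy]

theorem memLp_right (h : IsFourierPair κ q) : MemLp q 2 (volume : Measure ℝ) :=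
  (memLp_congr_ae h.coeFn_fourierInv_toLp).1 (Lp.memLp _)

theorem coeFn_fourierInv_reflect (h : IsFourierPair κ q) (ξ : ℝ) :
    ((𝓕⁻ ((h.memLp_reflect ξ).toLp _) : L2) : ℝ → ℂ) =ᵐ[volume]
      fun x => Complex.exp (2 * Real.pi * (x * ξ) * Complex.I) * conj (q x) := by
  have h1 : Integrable ((h.memLp_reflect ξ).toLp _ : ℝ → ℂ) (volume : Measure ℝ) :=
    (h.integrable_reflect ξ).congr (h.memLp_reflect ξ).coeFn_toLp.symm
  filter_upwards [fourierInv_coeFn_ae_eq h1] with x hx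
  rw [hx, Real.fourierInv_congr_ae (h.memLp_reflect ξ).coeFn_toLp, h.eq_fourierInv,
    Real.fourierInv_eq', Real.fourierInv_eq', ← integral_conj, ← integral_const_mul,
    ← integral_sub_left_eq_self _ volume ξ]
  refine integral_congr_ae (Eventually.of_forall fun y => ?_)
  simp only [smul_eq_mul, map_mul, ← Complex.exp_conj, sub_sub_cancel, RCLike.inner_apply,
    conj_trivial, Complex.conj_I, Complex.conj_ofReal]
  rw [← mul_assoc (Complex.exp _) (Complex.exp _), ← Complex.exp_add]
  congr 2
  push_cast
  ring

/-- Parseval, with `f` paired against e^{2πixξ} conj q: on the space side this is the Fourier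
integral of q f at ξ, on the frequency side the convolution at ξ. -/
theorem fourier_mulL2 (h : IsFourierPair κ q) (f : L2) :
    ((𝓕 (mulL2 q f) : L2) : ℝ → ℂ) =ᵐ[volume] fun ξ => ∫ η, κ (ξ - η) * (𝓕 f : L2) η := by
  have h1 : Integrable (mulL2 q f : ℝ → ℂ) (volume : Measure ℝ) :=
    (h.memLp_right.integrable_mul (Lp.memLp f)).congr (coeFn_mulL2 q f).symm
  filter_upwards [fourier_coeFn_ae_eq h1] with ξ hξ
  have h2 : inner ℂ (𝓕⁻ ((h.memLp_reflect ξ).toLp _) : L2) f =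
      inner ℂ ((h.memLp_reflect ξ).toLp _ : L2) (𝓕 f : L2) := by
    rw [← Lp.inner_fourier_eq, fourier_fourierInv_eq]
  rw [L2.inner_def, L2.inner_def] at h2
  rw [hξ, Real.fourier_eq']
  calc _ = _ := ?_
    _ = _ := h2
    _ = _ := ?_
  · refine integral_congr_ae ?_
    filter_upwards [coeFn_mulL2 q f, h.coeFn_fourierInv_reflect ξ] with x hx hx'
    have he : (starRingEnd ℂ) (Complex.exp (2 * Real.pi * (x * ξ) * Complex.I)) =
        Complex.exp ((-2 * Real.pi * (ξ * x) : ℝ) * Complex.I) := by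
      rw [← Complex.exp_conj]
      congr 1
      simp only [map_mul, Complex.conj_I, Complex.conj_ofReal, map_ofNat]
      push_cast
      ring
    simp only [hx, hx', RCLike.inner_apply, map_mul, he, smul_eq_mul, Complex.conj_conj,
      conj_trivial]
    ring
  · refine integral_congr_ae ?_
    filter_upwards [(h.memLp_reflect ξ).coeFn_toLp] with η hη
    rw [hη, RCLike.inner_apply]
    simp [mul_comm]

end IsFourierPair

/-! ### The derivative `-i d/dx` and the Hardy spaces -/

/-- `v = -i u'`, in terms of Fourier transforms. -/
def HasD (u v : L2) : Prop :=
  ((𝓕 v : L2) : ℝ → ℂ) =ᵐ[volume] fun ξ => ((2 * Real.pi * ξ : ℝ) : ℂ) * (𝓕 u : L2) ξ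

theorem coeFn_fourier_add (u v : L2) :
    ((𝓕 (u + v) : L2) : ℝ → ℂ) =ᵐ[volume] fun ξ => (𝓕 u : L2) ξ + (𝓕 v : L2) ξ := by
  rw [FourierTransform.fourier_add]
  exact Lp.coeFn_add _ _

theorem coeFn_fourier_smul (c : ℂ) (u : L2) :
    ((𝓕 (c • u) : L2) : ℝ → ℂ) =ᵐ[volume] fun ξ => c * (𝓕 u : L2) ξ := by
  rw [FourierTransform.fourier_smul]
  exact Lp.coeFn_smul _ _

theorem coeFn_fourier_zero : ((𝓕 (0 : L2) : L2) : ℝ → ℂ) =ᵐ[volume] fun _ => 0 := by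
  have h0 := coeFn_fourier_smul 0 0
  rw [zero_smul] at h0
  filter_upwards [h0] with ξ h
  rw [h, zero_mul]

theorem HasD.add {u v u' v' : L2} (h : HasD u v) (h' : HasD u' v') :
    HasD (u + u') (v + v') := by
  filter_upwards [h, h', coeFn_fourier_add u u', coeFn_fourier_add v v'] with ξ h1 h2 h3 h4
  rw [h4, h3, h1, h2, mul_add]

theorem HasD.smul {u v : L2} (c : ℂ) (h : HasD u v) : HasD (c • u) (c • v) := by
  filter_upwards [h, coeFn_fourier_smul c u, coeFn_fourier_smul c v] with ξ h1 h2 h3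
  rw [h3, h2, h1]
  ring

/-- The Hardy space of functions with Fourier transform supported on `{σ ξ ≥ 0}`. -/
def hardy (σ : ℝ) : Submodule ℂ L2 where
  carrier := {f | ∀ᵐ ξ, σ * ξ < 0 → (𝓕 f : L2) ξ = 0}
  add_mem' {f g} hf hg := by
    filter_upwards [hf, hg, coeFn_fourier_add f g] with ξ h1 h2 h3 h
    rw [h3, h1 h, h2 h, add_zero]
  zero_mem' := by
    filter_upwards [coeFn_fourier_zero] with ξ h1 _
    exact h1
  smul_mem' c f hf := by
    filter_upwards [hf, coeFn_fourier_smul c f] with ξ h1 h2 h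
    rw [h2, h1 h, mul_zero]

theorem mem_hardy {σ : ℝ} {f : L2} :
    f ∈ hardy σ ↔ ∀ᵐ ξ, σ * ξ < 0 → (𝓕 f : L2) ξ = 0 := Iff.rfl

theorem inner_eq_fourier (f g : L2) :
    inner ℂ f g = ∫ ξ, conj ((𝓕 f : L2) ξ) * (𝓕 g : L2) ξ := by
  rw [← Lp.inner_fourier_eq, L2.inner_def]
  refine integral_congr_ae (Eventually.of_forall fun ξ => ?_)
  simp only [RCLike.inner_apply]
  ring

theorem inner_eq_zero_of_hardy {f g : L2} (hf : f ∈ hardy (-1)) (hg : g ∈ hardy 1) :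
    inner ℂ f g = 0 := by
  rw [inner_eq_fourier]
  refine integral_eq_zero_of_ae ?_
  have h0 : ∀ᵐ ξ : ℝ, ξ ≠ 0 := by simp [ae_iff]
  filter_upwards [hf, hg, h0] with ξ h1 h2 h3
  rcases lt_or_gt_of_ne h3 with h | h
  · simp [h2 (by linarith)]
  · simp [h1 (by linarith)]

theorem eq_zero_of_hardy {f : L2} (hf : f ∈ hardy (-1)) (hg : f ∈ hardy 1) : f = 0 := by
  rw [← inner_self_eq_zero (𝕜 := ℂ)]
  exact inner_eq_zero_of_hardy hf hg

/-! ### The Sobolev space -/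

theorem memLp_sqrt_mul {f g : L2} (h : HasD f g) :
    MemLp (fun ξ : ℝ => (((1 + ‖ξ‖ ^ 2) ^ ((1 : ℝ) / 2) : ℝ) : ℂ) * (𝓕 f : L2) ξ) 2
      (volume : Measure ℝ) := by
  have h1 : MemLp (fun ξ => ‖(𝓕 f : L2) ξ‖ + ‖(𝓕 g : L2) ξ‖) 2 (volume : Measure ℝ) :=
    (Lp.memLp _).norm.add (Lp.memLp _).norm
  refine MemLp.of_le h1 ?_ ?_
  · refine AEStronglyMeasurable.mul ?_ (Lp.aestronglyMeasurable _)
    refine Continuous.aestronglyMeasurable ?_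
    refine Complex.continuous_ofReal.comp ?_
    exact Continuous.rpow_const (by fun_prop) fun ξ => Or.inl (by positivity)
  · filter_upwards [h] with ξ hξ
    have h2 : Real.sqrt (1 + ‖ξ‖ ^ 2) ≤ 1 + ‖ξ‖ := by
      refine Real.sqrt_le_iff.2 ⟨by positivity, ?_⟩
      nlinarith [norm_nonneg ξ]
    have h3 : 1 + ‖ξ‖ ≤ 1 + 2 * Real.pi * ‖ξ‖ := by
      nlinarith [norm_nonneg ξ, Real.pi_gt_three]
    have h4 : ‖2 * Real.pi * ξ‖ = 2 * Real.pi * ‖ξ‖ := by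
      rw [norm_mul, Real.norm_of_nonneg (by positivity)]
    have h5 : 0 ≤ ‖(𝓕 f : L2) ξ‖ + 2 * Real.pi * ‖ξ‖ * ‖(𝓕 f : L2) ξ‖ := by positivity
    rw [hξ, norm_mul, norm_mul, Complex.norm_real, Complex.norm_real, h4, Real.norm_of_nonneg h5,
      ← Real.sqrt_eq_rpow, Real.norm_of_nonneg (Real.sqrt_nonneg _)]
    calc _ ≤ (1 + 2 * Real.pi * ‖ξ‖) * ‖(𝓕 f : L2) ξ‖ :=
          mul_le_mul_of_nonneg_right (h2.trans h3) (norm_nonneg _)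
      _ = ‖(𝓕 f : L2) ξ‖ + 2 * Real.pi * ‖ξ‖ * ‖(𝓕 f : L2) ξ‖ := by ring

theorem HasD.mem_H1 {f g : L2} (h : HasD f g) : f ∈ H1 := by
  refine TemperedDistribution.memSobolev_iff_exists_smulLeftCLM_fourier.mpr
    ⟨(memLp_sqrt_mul h).toLp _, ?_⟩
  rw [Lp.fourier_toTemperedDistribution_eq]
  ext φ
  rw [TemperedDistribution.smulLeftCLM_apply_apply, Lp.toTemperedDistribution_apply,
    Lp.toTemperedDistribution_apply]
  refine integral_congr_ae ?_
  filter_upwards [(memLp_sqrt_mul h).coeFn_toLp] with ξ hξ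
  rw [hξ, SchwartzMap.smulLeftCLM_apply_apply (by fun_prop)]
  simp only [smul_eq_mul]
  ring

theorem exists_hasD (f : H1) : ∃ g, HasD (f : L2) g := by
  have h : MemLp (fun ξ => ((2 * Real.pi * ξ : ℝ) : ℂ) * (𝓕 (f : L2) : L2) ξ) 2
      (volume : Measure ℝ) := by
    refine MemLp.of_le (memLp_absSymbol_mul f.2) ?_ (Eventually.of_forall fun ξ => ?_)
    · refine AEStronglyMeasurable.mul ?_ (Lp.aestronglyMeasurable _)
      exact Continuous.aestronglyMeasurable (by fun_prop)
    · rw [norm_mul, norm_mul, absSymbol, Complex.norm_real, Complex.norm_real]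
      simp
  refine ⟨𝓕⁻ (h.toLp _), ?_⟩
  rw [HasD, fourier_fourierInv_eq]
  exact h.coeFn_toLp

theorem coeFn_fourier_absNabla (f : H1) :
    ((𝓕 (absNabla f) : L2) : ℝ → ℂ) =ᵐ[volume] fun ξ => absSymbol ξ * (𝓕 (f : L2) : L2) ξ := by
  change ((𝓕 (𝓕⁻ ((memLp_absSymbol_mul f.2).toLp _ : L2) : L2) : L2) : ℝ → ℂ) =ᵐ[volume] _
  rw [fourier_fourierInv_eq]
  exact (memLp_absSymbol_mul f.2).coeFn_toLp

theorem L2_ext_fourier {f g : L2} (h : ((𝓕 f : L2) : ℝ → ℂ) =ᵐ[volume] (𝓕 g : L2)) : f = g :=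
  (Lp.fourierTransformₗᵢ ℝ ℂ).injective (Lp.ext h)

/-- On the frequency support |ξ| = σξ, so |∇| is the first-order differential operator σD there. -/
theorem absNabla_of_hardy {σ : ℝ} (hσ : |σ| = 1) {f : H1} {g : L2} (h : HasD (f : L2) g)
    (hf : (f : L2) ∈ hardy σ) : absNabla f = (σ : ℂ) • g := by
  apply L2_ext_fourier
  filter_upwards [coeFn_fourier_absNabla f, coeFn_fourier_smul σ g, h, hf] with ξ h1 h2 h3 h4
  rw [h1, h2, h3]
  by_cases h5 : σ * ξ < 0
  · simp [h4 h5]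
  · have h6 : |ξ| = σ * ξ := by
      rw [← abs_of_nonneg (not_lt.1 h5), abs_mul, hσ, one_mul]
    rw [absSymbol, h6]
    push_cast
    ring

theorem norm_absNabla_eq {f : H1} {g : L2} (h : HasD (f : L2) g) : ‖absNabla f‖ = ‖g‖ := by
  rw [← Lp.norm_fourier_eq, ← Lp.norm_fourier_eq g]
  refine le_antisymm ?_ ?_ <;> refine Lp.norm_le_norm_of_ae_le ?_ <;>
    filter_upwards [coeFn_fourier_absNabla f, h] with ξ h1 h3 <;>
    simp [h1, h3, absSymbol]

theorem absNabla_symmetric (f g : H1) :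
    inner ℂ (absNabla f) (g : L2) = inner ℂ (f : L2) (absNabla g) := by
  rw [inner_eq_fourier, inner_eq_fourier]
  refine integral_congr_ae ?_
  filter_upwards [coeFn_fourier_absNabla f, coeFn_fourier_absNabla g] with ξ h1 h2
  rw [h1, h2, map_mul, absSymbol, Complex.conj_ofReal]
  ring

/-! ### Multiplication by inverse Fourier transforms -/

namespace IsFourierPair

variable {κ κ₁ : ℝ → ℂ} {q q₁ : ℝ →ᵇ ℂ}

theorem integrable_conv (h : IsFourierPair κ q) (f : L2) (ξ : ℝ) :
    Integrable (fun η => κ (ξ - η) * f η) (volume : Measure ℝ) := by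
  have h1 : MemLp (fun η => κ (ξ - η)) 2 (volume : Measure ℝ) :=
    h.memLp.comp_measurePreserving (Measure.measurePreserving_sub_left volume ξ)
  exact h1.integrable_mul (Lp.memLp f)

theorem star (h : IsFourierPair κ q) : IsFourierPair (fun ξ => conj (κ (-ξ))) (star q) where
  integrable := by simpa using h.integrable_reflect 0
  memLp := by simpa using h.memLp_reflect 0
  eq_fourierInv x := by
    rw [BoundedContinuousFunction.star_apply, h.eq_fourierInv, Real.fourierInv_eq',
      Real.fourierInv_eq', ← integral_neg_eq_self, RCLike.star_def, ← integral_conj]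
    refine integral_congr_ae (Eventually.of_forall fun y => ?_)
    simp only [smul_eq_mul, map_mul, ← Complex.exp_conj, RCLike.inner_apply,
      conj_trivial, Complex.conj_I, Complex.conj_ofReal]
    congr 2
    push_cast
    ring

theorem smul (c : ℂ) (h : IsFourierPair κ q) : IsFourierPair (fun ξ => c * κ ξ) (c • q) where
  integrable := h.integrable.const_mul c
  memLp := h.memLp.const_mul c
  eq_fourierInv x := by
    rw [BoundedContinuousFunction.smul_apply, h.eq_fourierInv, Real.fourierInv_eq',
      Real.fourierInv_eq', ← integral_smul]
    refine integral_congr_ae (Eventually.of_forall fun y => ?_)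
    simp only [smul_eq_mul]
    ring

theorem fourier_toLp (h : IsFourierPair κ q) :
    (𝓕 (h.memLp_right.toLp q : L2) : L2) = h.memLp.toLp κ := by
  have h1 : (h.memLp_right.toLp q : L2) = 𝓕⁻ (h.memLp.toLp κ : L2) :=
    Lp.ext (h.memLp_right.coeFn_toLp.trans h.coeFn_fourierInv_toLp.symm)
  rw [h1, fourier_fourierInv_eq]

/-- If σξ < 0, then for every η either ση < 0 or σ(ξ - η) < 0, so the convolution integrand
vanishes. -/
theorem mulL2_mem_hardy (h : IsFourierPair κ q) {σ : ℝ} (hκ : ∀ ξ, σ * ξ < 0 → κ ξ = 0)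
    {f : L2} (hf : f ∈ hardy σ) : mulL2 q f ∈ hardy σ := by
  filter_upwards [h.fourier_mulL2 f] with ξ hξ hneg
  rw [hξ]
  refine integral_eq_zero_of_ae ?_
  filter_upwards [hf] with η hη
  by_cases h1 : σ * η < 0
  · simp [hη h1]
  · rw [hκ (ξ - η) (by linarith), zero_mul]
    rfl

theorem toLp_mem_hardy (h : IsFourierPair κ q) {σ : ℝ} (hκ : ∀ ξ, σ * ξ < 0 → κ ξ = 0) :
    h.memLp_right.toLp q ∈ hardy σ := by
  rw [mem_hardy, h.fourier_toLp]
  filter_upwards [h.memLp.coeFn_toLp] with ξ hξ hneg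
  rw [hξ, hκ ξ hneg]

theorem hasD_toLp (h : IsFourierPair κ q)
    (h₁ : IsFourierPair (fun ξ => ((2 * Real.pi * ξ : ℝ) : ℂ) * κ ξ) q₁) :
    HasD (h.memLp_right.toLp q) (h₁.memLp_right.toLp q₁) := by
  rw [HasD, h.fourier_toLp, h₁.fourier_toLp]
  filter_upwards [h.memLp.coeFn_toLp, h₁.memLp.coeFn_toLp] with ξ e1 e2
  rw [e1, e2]

/-- Leibniz rule: split 2πξ = 2πη + 2π(ξ - η) inside the convolution. -/
theorem hasD_mulL2 (h : IsFourierPair κ q)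
    (h₁ : IsFourierPair (fun ξ => ((2 * Real.pi * ξ : ℝ) : ℂ) * κ ξ) q₁) {f g : L2}
    (hf : HasD f g) : HasD (mulL2 q f) (mulL2 q g + mulL2 q₁ f) := by
  filter_upwards [coeFn_fourier_add (mulL2 q g) (mulL2 q₁ f), h.fourier_mulL2 f,
    h.fourier_mulL2 g, h₁.fourier_mulL2 f] with ξ e1 e2 e3 e4
  rw [e1, e2, e3, e4, ← integral_add (h.integrable_conv _ ξ) (h₁.integrable_conv _ ξ),
    ← integral_const_mul]
  refine integral_congr_ae ?_
  filter_upwards [hf] with η hη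
  rw [hη]
  push_cast
  ring

end IsFourierPair

/-! ### The Cayley transform as a bounded continuous function -/

theorem sub_I_ne_zero (x : ℝ) : (x : ℂ) - Complex.I ≠ 0 := by
  intro h
  have h1 := norm_sub_I_sq x
  rw [h, norm_zero] at h1
  nlinarith [sq_nonneg x]

/-- The function `1/(x + i)`. -/
def invAddI : ℝ →ᵇ ℂ :=
  BoundedContinuousFunction.ofNormedAddCommGroup (fun x : ℝ => ((x : ℂ) + Complex.I)⁻¹)
    (Continuous.inv₀ (by fun_prop) add_I_ne_zero) 1 (fun x => by
      rw [norm_inv]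
      refine inv_le_one_of_one_le₀ ?_
      have h := norm_add_I_sq x
      nlinarith [sq_nonneg x, norm_nonneg ((x : ℂ) + Complex.I)])

@[simp] theorem invAddI_apply (x : ℝ) : invAddI x = ((x : ℂ) + Complex.I)⁻¹ := rfl

@[simp] theorem star_invAddI_apply (x : ℝ) : (star invAddI) x = ((x : ℂ) - Complex.I)⁻¹ := by
  rw [BoundedContinuousFunction.star_apply, invAddI_apply, RCLike.star_def, map_inv₀, map_add,
    Complex.conj_I, Complex.conj_ofReal, sub_eq_add_neg]

theorem inv_sub_I_sub_inv_add_I (x : ℝ) :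
    ((x : ℂ) - Complex.I)⁻¹ - ((x : ℂ) + Complex.I)⁻¹ =
      2 * Complex.I * (((x : ℂ) + Complex.I)⁻¹ * ((x : ℂ) - Complex.I)⁻¹) := by
  rw [inv_sub_inv (sub_I_ne_zero x) (add_I_ne_zero x), div_eq_mul_inv, mul_inv]
  ring

/-- The Cayley transform `(x - i)/(x + i)`. -/
def cayley : (ℝ →ᵇ ℂ)ˣ where
  val := 1 - (2 * Complex.I) • invAddI
  inv := 1 + (2 * Complex.I) • star invAddI
  val_inv := by
    ext x
    simp only [BoundedContinuousFunction.mul_apply, BoundedContinuousFunction.sub_apply,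
      BoundedContinuousFunction.add_apply, BoundedContinuousFunction.smul_apply,
      BoundedContinuousFunction.coe_one, Pi.one_apply, smul_eq_mul, invAddI_apply, star_invAddI_apply]
    linear_combination (2 * Complex.I) * inv_sub_I_sub_inv_add_I x
  inv_val := by
    ext x
    simp only [BoundedContinuousFunction.mul_apply, BoundedContinuousFunction.sub_apply,
      BoundedContinuousFunction.add_apply, BoundedContinuousFunction.smul_apply,
      BoundedContinuousFunction.coe_one, Pi.one_apply, smul_eq_mul, invAddI_apply, star_invAddI_apply]
    linear_combination (2 * Complex.I) * inv_sub_I_sub_inv_add_I x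

theorem cayley_val : (cayley : ℝ →ᵇ ℂ) = 1 - (2 * Complex.I) • invAddI := rfl

theorem cayley_inv : ((cayley⁻¹ : (ℝ →ᵇ ℂ)ˣ) : ℝ →ᵇ ℂ) = 1 + (2 * Complex.I) • star invAddI := rfl

theorem cayley_apply (x : ℝ) :
    (cayley : ℝ →ᵇ ℂ) x = ((x : ℂ) - Complex.I) / ((x : ℂ) + Complex.I) := by
  simp [cayley_val]
  field_simp [add_I_ne_zero x]
  ring

theorem star_cayley : star (cayley : ℝ →ᵇ ℂ) = ((cayley⁻¹ : (ℝ →ᵇ ℂ)ˣ) : ℝ →ᵇ ℂ) := by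
  rw [cayley_val, cayley_inv, star_sub, star_smul, star_one]
  simp

theorem star_cayley_zpow (n : ℤ) :
    star ((cayley ^ n : (ℝ →ᵇ ℂ)ˣ) : ℝ →ᵇ ℂ) = ((cayley ^ (-n) : (ℝ →ᵇ ℂ)ˣ) : ℝ →ᵇ ℂ) := by
  have h : star cayley = cayley⁻¹ := Units.ext star_cayley
  rw [← Units.coe_star, star_zpow, h, inv_zpow, zpow_neg]

/-- `1/(1 + x²)` is a product. -/
theorem invAddI_mul_star_apply (x : ℝ) :
    (invAddI * star invAddI) x = (((1 + x ^ 2)⁻¹ : ℝ) : ℂ) := by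
  rw [BoundedContinuousFunction.mul_apply, invAddI_apply, star_invAddI_apply, ← mul_inv]
  push_cast
  congr 1
  linear_combination -Complex.I_sq

theorem I_smul_invAddI :
    Complex.I • invAddI = (1 / 2 : ℂ) • (1 - (cayley : ℝ →ᵇ ℂ)) := by
  rw [cayley_val, sub_sub_cancel, smul_smul]
  congr 1
  ring

/-- Written through c and its inverse, the weight becomes tridiagonal on the powers of c. -/
theorem invAddI_mul_star :
    invAddI * star invAddI = (1 / 4 : ℂ) • (2 - (cayley : ℝ →ᵇ ℂ) - (cayley⁻¹ : (ℝ →ᵇ ℂ)ˣ)) := by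
  ext x
  have h3 : ((2 : ℝ →ᵇ ℂ)) x = 2 := rfl
  simp only [cayley_val, cayley_inv, BoundedContinuousFunction.mul_apply,
    BoundedContinuousFunction.sub_apply, BoundedContinuousFunction.add_apply,
    BoundedContinuousFunction.smul_apply, BoundedContinuousFunction.coe_one, Pi.one_apply, smul_eq_mul,
    invAddI_apply, star_invAddI_apply, h3]
  linear_combination (Complex.I / 2) * inv_sub_I_sub_inv_add_I x +
    (((x : ℂ) + Complex.I)⁻¹ * ((x : ℂ) - Complex.I)⁻¹) * Complex.I_sq

/-! ### Fourier transforms of `1/(x + i)` and `1/(x - i)` -/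

/-- The Fourier transform of `1/(x + i)`. -/
def expKernel : ℝ → ℂ :=
  (Set.Ioi (0 : ℝ)).indicator fun ξ => -(2 * Real.pi * Complex.I) * (Real.exp (-2 * Real.pi * ξ) : ℂ)

theorem expKernel_of_neg {ξ : ℝ} (h : ξ < 0) : expKernel ξ = 0 :=
  Set.indicator_of_notMem (by simp [h.le]) _

theorem expKernel_of_pos {ξ : ℝ} (h : 0 < ξ) :
    expKernel ξ = -(2 * Real.pi * Complex.I) * (Real.exp (-2 * Real.pi * ξ) : ℂ) :=
  Set.indicator_of_mem (by simpa using h) _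

theorem integrableOn_pow_mul_exp (n : ℕ) {b : ℝ} (hb : 0 < b) :
    IntegrableOn (fun ξ : ℝ => ξ ^ n * Real.exp (-b * ξ)) (Set.Ioi 0) (volume : Measure ℝ) := by
  have h := integrableOn_rpow_mul_exp_neg_mul_rpow (s := n) (p := 1) (b := b)
    (by have : (0 : ℝ) ≤ n := by positivity
        linarith) one_pos hb
  simpa using h

theorem integrableOn_pow_mul_cexp (n : ℕ) {r : ℂ} (hr : 0 < r.re) :
    IntegrableOn (fun ξ : ℝ => (ξ : ℂ) ^ n * Complex.exp (-r * ξ)) (Set.Ioi 0)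
      (volume : Measure ℝ) := by
  refine Integrable.mono' (integrableOn_pow_mul_exp n hr)
    (Continuous.aestronglyMeasurable (by fun_prop)) ?_
  filter_upwards [self_mem_ae_restrict measurableSet_Ioi] with ξ hξ
  rw [norm_mul, norm_pow, Complex.norm_real, Real.norm_of_nonneg (le_of_lt hξ), Complex.norm_exp]
  simp

/-- Induction on n: the derivative of ξ^(n+1) e^{-rξ} integrates to zero over the half-line. -/
theorem integral_pow_mul_cexp (n : ℕ) {r : ℂ} (hr : 0 < r.re) :
    ∫ ξ : ℝ in Set.Ioi 0, (ξ : ℂ) ^ n * Complex.exp (-r * ξ) = n.factorial * (1 / r) ^ (n + 1) := by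
  have hr0 : r ≠ 0 := by
    rintro rfl
    simp at hr
  have hexp (x : ℝ) : HasDerivAt (fun ξ : ℝ => Complex.exp (-r * ξ))
      (Complex.exp (-r * x) * -r) x := by
    have := (((hasDerivAt_id (x : ℂ)).const_mul (-r)).cexp).comp_ofReal
    simpa using this
  induction n with
  | zero =>
    have h0 := integrableOn_pow_mul_cexp 0 hr
    simp only [pow_zero, one_mul] at h0
    have h := integral_Ioi_of_hasDerivAt_of_tendsto' (a := 0) (m := 0) (fun x _ => hexp x)
      (h0.mul_const (-r)) (tendsto_zero_of_hasDerivAt_of_integrableOn_Ioi (a := 0)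
        (fun x _ => hexp x) (h0.mul_const (-r)) h0)
    rw [integral_mul_const] at h
    simp only [pow_zero, one_mul, Nat.factorial_zero, Nat.cast_one, zero_add, pow_one]
    field_simp
    simp at h
    linear_combination h
  | succ n ih =>
    have hd (x : ℝ) : HasDerivAt (fun ξ : ℝ => (ξ : ℂ) ^ (n + 1) * Complex.exp (-r * ξ))
        ((n + 1) * ((x : ℂ) ^ n * Complex.exp (-r * x)) -
          r * ((x : ℂ) ^ (n + 1) * Complex.exp (-r * x))) x := by
      have h1 := ((hasDerivAt_pow (n + 1) (x : ℂ)).comp_ofReal).mul (hexp x)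
      refine h1.congr_deriv ?_
      push_cast
      ring
    have hi := ((integrableOn_pow_mul_cexp n hr).const_mul ((n : ℂ) + 1)).sub
      ((integrableOn_pow_mul_cexp (n + 1) hr).const_mul r)
    have h := integral_Ioi_of_hasDerivAt_of_tendsto' (a := 0) (m := 0) (fun x _ => hd x) hi
      (tendsto_zero_of_hasDerivAt_of_integrableOn_Ioi (a := 0) (fun x _ => hd x) hi
        (integrableOn_pow_mul_cexp (n + 1) hr))
    rw [integral_sub ((integrableOn_pow_mul_cexp n hr).const_mul _)
      ((integrableOn_pow_mul_cexp (n + 1) hr).const_mul r), integral_const_mul,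
      integral_const_mul, ih] at h
    simp only [Complex.ofReal_zero, ne_eq, Nat.add_eq_zero_iff, one_ne_zero, and_false,
      not_false_eq_true, zero_pow, zero_mul, sub_self] at h
    rw [sub_eq_zero] at h
    rw [Nat.factorial_succ, pow_succ (1 / r) (n + 1)]
    refine mul_left_cancel₀ hr0 ?_
    rw [← h]
    push_cast
    field_simp

theorem memLp_indicator_pow_mul_exp (n : ℕ) (c : ℂ) :
    MemLp ((Set.Ioi (0 : ℝ)).indicator fun ξ => c * ((ξ : ℂ) ^ n * (Real.exp (-2 * Real.pi * ξ) : ℂ)))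
      2 (volume : Measure ℝ) := by
  have hm : Measurable ((Set.Ioi (0 : ℝ)).indicator
      fun ξ => c * ((ξ : ℂ) ^ n * (Real.exp (-2 * Real.pi * ξ) : ℂ))) :=
    Measurable.indicator (by fun_prop) measurableSet_Ioi
  rw [memLp_two_iff_integrable_sq_norm hm.aestronglyMeasurable]
  have h := (integrable_indicator_iff measurableSet_Ioi).2
    ((integrableOn_pow_mul_exp (2 * n) (b := 4 * Real.pi) (by positivity)).const_mul (‖c‖ ^ 2))
  refine h.congr (Eventually.of_forall fun ξ => ?_)
  by_cases hξ : ξ ∈ Set.Ioi (0 : ℝ)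
  · simp only [Set.indicator_of_mem hξ, norm_mul, norm_pow, Complex.norm_real, mul_pow,
      Real.norm_of_nonneg (le_of_lt hξ), Real.norm_of_nonneg (Real.exp_pos _).le]
    rw [← pow_mul, ← Real.exp_nat_mul]
    ring_nf
  · simp [Set.indicator_of_notMem hξ]

theorem integrable_indicator_pow_mul_exp (n : ℕ) (c : ℂ) :
    Integrable ((Set.Ioi (0 : ℝ)).indicator
      fun ξ => c * ((ξ : ℂ) ^ n * (Real.exp (-2 * Real.pi * ξ) : ℂ))) (volume : Measure ℝ) := by
  rw [integrable_indicator_iff measurableSet_Ioi]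
  refine Integrable.const_mul ?_ _
  have h := (integrableOn_pow_mul_exp n (b := 2 * Real.pi) (by positivity)).ofReal (𝕜 := ℂ)
  refine h.congr (Eventually.of_forall fun ξ => ?_)
  simp

/-- The Laplace integral at r = 2π(1 - ix) = -2πi(x + i), whose inverse is i/(2π(x + i)). -/
theorem fourierInv_indicator_pow_mul_exp (n : ℕ) (c : ℂ) (x : ℝ) :
    𝓕⁻ ((Set.Ioi (0 : ℝ)).indicator
      fun ξ => c * ((ξ : ℂ) ^ n * (Real.exp (-2 * Real.pi * ξ) : ℂ))) x =
      c * (n.factorial * (Complex.I * invAddI x / (2 * Real.pi)) ^ (n + 1)) := by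
  have hr : 0 < (2 * Real.pi * (1 - x * Complex.I)).re := by
    have : (2 * Real.pi * (1 - x * Complex.I)).re = 2 * Real.pi := by simp
    rw [this]
    positivity
  have h := integral_pow_mul_cexp n hr
  have h2 : 1 / (2 * Real.pi * (1 - x * Complex.I)) = Complex.I * invAddI x / (2 * Real.pi) := by
    have h3 := add_I_ne_zero x
    have h4 : (1 : ℂ) - x * Complex.I = -Complex.I * (x + Complex.I) := by
      linear_combination Complex.I_sq
    rw [h4, invAddI_apply]
    field_simp
    rw [Complex.I_sq]
  rw [h2] at h
  rw [← h, Real.fourierInv_eq', ← integral_const_mul, ← integral_indicator measurableSet_Ioi]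
  refine integral_congr_ae (Eventually.of_forall fun ξ => ?_)
  by_cases hξ : ξ ∈ Set.Ioi (0 : ℝ)
  · simp only [Set.indicator_of_mem hξ]
    have h5 : Complex.exp (-(2 * Real.pi * (1 - x * Complex.I)) * ξ) =
        Complex.exp ((2 * Real.pi * (x * ξ) : ℝ) * Complex.I) *
          Complex.exp ((-2 * Real.pi * ξ : ℝ)) := by
      rw [← Complex.exp_add]
      congr 1
      push_cast
      ring
    simp only [h5, smul_eq_mul, Complex.ofReal_exp, RCLike.inner_apply, conj_trivial]
    ring
  · simp [Set.indicator_of_notMem hξ]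

theorem isFourierPair_expKernel : IsFourierPair expKernel invAddI := by
  have h : expKernel = (Set.Ioi (0 : ℝ)).indicator fun ξ => -(2 * Real.pi * Complex.I) *
      ((ξ : ℂ) ^ 0 * (Real.exp (-2 * Real.pi * ξ) : ℂ)) := by
    simp [expKernel]
  refine ⟨?_, ?_, fun x => ?_⟩
  · rw [h]; exact integrable_indicator_pow_mul_exp _ _
  · rw [h]; exact memLp_indicator_pow_mul_exp _ _
  · rw [h, fourierInv_indicator_pow_mul_exp]
    have hπ : (Real.pi : ℂ) ≠ 0 := Complex.ofReal_ne_zero.2 Real.pi_ne_zero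
    generalize invAddI x = p
    simp only [Nat.factorial_zero, Nat.cast_one, zero_add, pow_one, one_mul]
    field_simp
    linear_combination p * Complex.I_sq

theorem isFourierPair_mul_expKernel :
    IsFourierPair (fun ξ => ((2 * Real.pi * ξ : ℝ) : ℂ) * expKernel ξ)
      (Complex.I • (invAddI * invAddI)) := by
  have h : (fun ξ => ((2 * Real.pi * ξ : ℝ) : ℂ) * expKernel ξ) =
      (Set.Ioi (0 : ℝ)).indicator fun ξ => -((2 * Real.pi) ^ 2 * Complex.I) *
      ((ξ : ℂ) ^ 1 * (Real.exp (-2 * Real.pi * ξ) : ℂ)) := by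
    ext ξ
    by_cases hξ : ξ ∈ Set.Ioi (0 : ℝ)
    · rw [expKernel, Set.indicator_of_mem hξ, Set.indicator_of_mem hξ]
      push_cast
      ring
    · rw [expKernel, Set.indicator_of_notMem hξ, Set.indicator_of_notMem hξ, mul_zero]
  refine ⟨?_, ?_, fun x => ?_⟩
  · rw [h]; exact integrable_indicator_pow_mul_exp _ _
  · rw [h]; exact memLp_indicator_pow_mul_exp _ _
  · rw [h, fourierInv_indicator_pow_mul_exp]
    simp only [BoundedContinuousFunction.smul_apply, BoundedContinuousFunction.mul_apply,
      smul_eq_mul, Nat.factorial_one, Nat.cast_one, one_add_one_eq_two]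
    have hπ : (Real.pi : ℂ) ≠ 0 := Complex.ofReal_ne_zero.2 Real.pi_ne_zero
    generalize invAddI x = p
    rw [div_pow, mul_pow Complex.I, Complex.I_sq]
    field_simp

theorem isFourierPair_mul_star_expKernel :
    IsFourierPair (fun ξ => ((2 * Real.pi * ξ : ℝ) : ℂ) * conj (expKernel (-ξ)))
      (Complex.I • (star invAddI * star invAddI)) := by
  -- The reflection ξ ↦ -ξ flips the sign of the factor 2πξ; the scalar -1 restores it.
  have h := isFourierPair_mul_expKernel.star.smul (-1)
  have h1 : (-1 : ℂ) • star (Complex.I • (invAddI * invAddI)) =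
      Complex.I • (star invAddI * star invAddI) := by
    rw [star_smul, star_mul, smul_smul]
    simp
  rw [h1] at h
  convert h using 2 with ξ
  rw [map_mul, Complex.conj_ofReal]
  push_cast
  ring

theorem star_invAddI_mul_cayley : star invAddI * (cayley : ℝ →ᵇ ℂ) = invAddI := by
  ext x
  rw [BoundedContinuousFunction.mul_apply, cayley_apply, star_invAddI_apply, invAddI_apply]
  have h := sub_I_ne_zero x
  rw [div_eq_mul_inv, ← mul_assoc, inv_mul_cancel₀ h, one_mul]

theorem invAddI_mul_cayley_inv :
    invAddI * ((cayley⁻¹ : (ℝ →ᵇ ℂ)ˣ) : ℝ →ᵇ ℂ) = star invAddI := by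
  rw [Units.mul_inv_eq_iff_eq_mul, star_invAddI_mul_cayley]

/-! ### Multiplication by powers of the Cayley transform -/

/-- Multiplication by the `n`-th power of the Cayley transform. -/
def cayleyMul (n : ℤ) : L2 →L[ℂ] L2 := mulL2 ((cayley ^ n : (ℝ →ᵇ ℂ)ˣ) : ℝ →ᵇ ℂ)

theorem cayleyMul_zero (f : L2) : cayleyMul 0 f = f := by
  rw [cayleyMul, zpow_zero, Units.val_one, mulL2_one]

theorem cayleyMul_add (a b : ℤ) (f : L2) : cayleyMul (a + b) f = cayleyMul a (cayleyMul b f) := by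
  rw [cayleyMul, cayleyMul, cayleyMul, zpow_add, Units.val_mul, mulL2_mul]

theorem cayleyMul_one (f : L2) : cayleyMul 1 f = f - (2 * Complex.I) • mulL2 invAddI f := by
  rw [cayleyMul, zpow_one, cayley_val, mulL2_sub, mulL2_one, mulL2_smul]

theorem cayleyMul_neg_one (f : L2) :
    cayleyMul (-1) f = f + (2 * Complex.I) • mulL2 (star invAddI) f := by
  rw [cayleyMul, zpow_neg_one, cayley_inv, mulL2_add, mulL2_one, mulL2_smul]

theorem cayleyMul_neg_cayleyMul (n : ℤ) (f : L2) : cayleyMul (-n) (cayleyMul n f) = f := by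
  rw [← cayleyMul_add, neg_add_cancel, cayleyMul_zero]

theorem cayleyMul_cayleyMul_neg (n : ℤ) (f : L2) : cayleyMul n (cayleyMul (-n) f) = f := by
  rw [← cayleyMul_add, add_neg_cancel, cayleyMul_zero]

theorem mulL2_cayleyMul_comm (q : ℝ →ᵇ ℂ) (n : ℤ) (f : L2) :
    mulL2 q (cayleyMul n f) = cayleyMul n (mulL2 q f) := by
  rw [cayleyMul, ← mulL2_mul, mul_comm, mulL2_mul]

theorem inner_cayleyMul_left (n : ℤ) (f g : L2) :
    inner ℂ (cayleyMul n f) g = inner ℂ f (cayleyMul (-n) g) := by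
  rw [cayleyMul, inner_mulL2_left, star_cayley_zpow, cayleyMul]

theorem star_expKernel_apply_of_pos {ξ : ℝ} (h : 0 < ξ) : conj (expKernel (-ξ)) = 0 := by
  rw [expKernel_of_neg (by linarith), map_zero]

/-- c = 1 - 2i/(x + i), and 1/(x + i) has only positive frequencies. -/
theorem cayleyMul_mem_hardy_one {n : ℤ} (hn : 0 ≤ n) {f : L2} (hf : f ∈ hardy 1) :
    cayleyMul n f ∈ hardy 1 := by
  induction n, hn using Int.leInduction with
  | base => rwa [cayleyMul_zero]
  | succ n hn ih =>
    rw [add_comm, cayleyMul_add, cayleyMul_one]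
    refine sub_mem ih (Submodule.smul_mem _ _ ?_)
    exact isFourierPair_expKernel.mulL2_mem_hardy (fun ξ h => expKernel_of_neg (by linarith)) ih

theorem cayleyMul_mem_hardy_neg_one {n : ℤ} (hn : n ≤ 0) {f : L2} (hf : f ∈ hardy (-1)) :
    cayleyMul n f ∈ hardy (-1) := by
  induction n, hn using Int.leInductionDown with
  | base => rwa [cayleyMul_zero]
  | pred n hn ih =>
    rw [sub_eq_add_neg, add_comm, cayleyMul_add, cayleyMul_neg_one]
    refine add_mem ih (Submodule.smul_mem _ _ ?_)
    exact isFourierPair_expKernel.star.mulL2_mem_hardy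
      (fun ξ h => star_expKernel_apply_of_pos (by linarith)) ih

/-- Multiplication by `1/(1 + x²)`. -/
def weightMul : L2 →L[ℂ] L2 := mulL2 (invAddI * star invAddI)

theorem hasD_cayleyMul_one {f g : L2} (h : HasD f g) :
    HasD (cayleyMul 1 f) (cayleyMul 1 g + (2 : ℂ) • weightMul (cayleyMul 1 f)) := by
  have h1 := (isFourierPair_expKernel.hasD_mulL2 isFourierPair_mul_expKernel h).smul
    (-(2 * Complex.I))
  have h2 := h.add h1
  convert h2 using 1
  · rw [cayleyMul_one]
    module
  · rw [cayleyMul_one g, weightMul, cayleyMul, zpow_one, ← mulL2_mul, mul_assoc,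
      star_invAddI_mul_cayley, mulL2_smul]
    have h3 : (-(2 * Complex.I)) * Complex.I = 2 := by linear_combination (-2) * Complex.I_sq
    rw [smul_add, smul_smul, h3]
    module

theorem hasD_cayleyMul_neg_one {f g : L2} (h : HasD f g) :
    HasD (cayleyMul (-1) f) (cayleyMul (-1) g + (-2 : ℂ) • weightMul (cayleyMul (-1) f)) := by
  have h1 := (isFourierPair_expKernel.star.hasD_mulL2 isFourierPair_mul_star_expKernel h).smul
    (2 * Complex.I)
  have h2 := h.add h1
  convert h2 using 1
  · rw [cayleyMul_neg_one]
  · rw [cayleyMul_neg_one g, weightMul, cayleyMul, zpow_neg_one, ← mulL2_mul,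
      mul_comm invAddI, mul_assoc, invAddI_mul_cayley_inv, mulL2_smul]
    have h3 : (2 * Complex.I) * Complex.I = -2 := by linear_combination 2 * Complex.I_sq
    rw [smul_add, smul_smul, h3]
    module

/-- Leibniz rule with D c^n = 2n c^n/(1+x²). For n = ±m the extra term is what cancels the
potential. -/
theorem hasD_cayleyMul {f g : L2} (h : HasD f g) (n : ℤ) :
    HasD (cayleyMul n f) (cayleyMul n g + (2 * n : ℂ) • weightMul (cayleyMul n f)) := by
  induction n with
  | zero => simpa [cayleyMul_zero] using h
  | succ n ih =>
    have h1 := hasD_cayleyMul_one ih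
    rw [add_comm, cayleyMul_add]
    convert h1 using 1
    rw [cayleyMul_add, map_add, map_smul]
    simp only [weightMul, mulL2_cayleyMul_comm]
    push_cast
    module
  | pred n ih =>
    have h1 := hasD_cayleyMul_neg_one ih
    rw [sub_eq_add_neg, add_comm, cayleyMul_add]
    convert h1 using 1
    rw [cayleyMul_add, map_add, map_smul]
    simp only [weightMul, mulL2_cayleyMul_comm]
    push_cast
    module

/-! ### The rational orthogonal basis -/

/-- The function `(x - i)^n / (x + i)^(n+1)`. -/
def ratBasis (n : ℤ) : L2 := cayleyMul n (isFourierPair_expKernel.memLp_right.toLp invAddI)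

theorem cayleyMul_ratBasis (a b : ℤ) : cayleyMul a (ratBasis b) = ratBasis (a + b) := by
  rw [ratBasis, ratBasis, cayleyMul_add]

theorem ratBasis_zero : ratBasis 0 = isFourierPair_expKernel.memLp_right.toLp invAddI :=
  cayleyMul_zero _

theorem mulL2_toLp {p q r : ℝ →ᵇ ℂ} (hq : MemLp q 2 (volume : Measure ℝ))
    (hr : MemLp r 2 (volume : Measure ℝ)) (h : p * q = r) :
    mulL2 p (hq.toLp q) = hr.toLp r := by
  apply Lp.ext
  filter_upwards [coeFn_mulL2 p (hq.toLp q), hq.coeFn_toLp, hr.coeFn_toLp] with x h1 h2 h3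
  rw [h1, h2, h3, ← h, BoundedContinuousFunction.mul_apply]

theorem ratBasis_neg_one :
    ratBasis (-1) = isFourierPair_expKernel.star.memLp_right.toLp (⇑(star invAddI)) := by
  refine mulL2_toLp isFourierPair_expKernel.memLp_right
    isFourierPair_expKernel.star.memLp_right ?_
  rw [zpow_neg_one, mul_comm, invAddI_mul_cayley_inv]

theorem ratBasis_mem_hardy_one {n : ℤ} (hn : 0 ≤ n) : ratBasis n ∈ hardy 1 :=
  cayleyMul_mem_hardy_one hn
    (isFourierPair_expKernel.toLp_mem_hardy fun _ h => expKernel_of_neg (by linarith))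

theorem ratBasis_mem_hardy_neg_one {n : ℤ} (hn : n < 0) : ratBasis n ∈ hardy (-1) := by
  have h : ratBasis n = cayleyMul (n + 1) (ratBasis (-1)) := by
    rw [cayleyMul_ratBasis]
    congr 1
    ring
  rw [h, ratBasis_neg_one]
  exact cayleyMul_mem_hardy_neg_one (by linarith)
    (isFourierPair_expKernel.star.toLp_mem_hardy
      fun _ h => star_expKernel_apply_of_pos (by linarith))

/-- Multiplication by c^{-k} is unitary and moves the pair to e_{j-k} in H₋ and e_0 in H₊. -/
theorem inner_ratBasis_of_lt {j k : ℤ} (h : j < k) : inner ℂ (ratBasis j) (ratBasis k) = 0 := by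
  have h1 : ratBasis j = cayleyMul k (ratBasis (j - k)) := by
    rw [cayleyMul_ratBasis]
    congr 1
    ring
  rw [h1, inner_cayleyMul_left, cayleyMul_ratBasis, neg_add_cancel]
  exact inner_eq_zero_of_hardy (ratBasis_mem_hardy_neg_one (by linarith))
    (ratBasis_mem_hardy_one le_rfl)

theorem inner_ratBasis_zero : inner ℂ (ratBasis 0) (ratBasis 0) = (Real.pi : ℂ) := by
  rw [ratBasis_zero, L2.inner_def, ← integral_univ_inv_one_add_sq, ← integral_complex_ofReal]
  refine integral_congr_ae ?_
  filter_upwards [isFourierPair_expKernel.memLp_right.coeFn_toLp] with x h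
  have h1 : (starRingEnd ℂ) (invAddI x) = (star invAddI) x := rfl
  rw [h, RCLike.inner_apply, h1, ← BoundedContinuousFunction.mul_apply, invAddI_mul_star_apply]

theorem inner_ratBasis (j k : ℤ) :
    inner ℂ (ratBasis j) (ratBasis k) = if j = k then (Real.pi : ℂ) else 0 := by
  split_ifs with h
  · subst h
    rw [ratBasis, inner_cayleyMul_left, cayleyMul_neg_cayleyMul, ← ratBasis_zero,
      inner_ratBasis_zero]
  · rcases lt_or_gt_of_ne h with h1 | h1
    · exact inner_ratBasis_of_lt h1
    · rw [← inner_conj_symm, inner_ratBasis_of_lt h1, map_zero]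

theorem weightMul_eq (f : L2) :
    weightMul f = (1 / 4 : ℂ) • ((2 : ℂ) • f - cayleyMul 1 f - cayleyMul (-1) f) := by
  have h : (2 : ℝ →ᵇ ℂ) = (2 : ℂ) • (1 : ℝ →ᵇ ℂ) := by
    ext x
    simp
  rw [weightMul, invAddI_mul_star, mulL2_smul, mulL2_sub, mulL2_sub, cayleyMul, cayleyMul,
    zpow_one, zpow_neg_one, h, mulL2_smul, mulL2_one]

theorem weightMul_ratBasis (n : ℤ) :
    weightMul (ratBasis n) =
      (1 / 4 : ℂ) • ((2 : ℂ) • ratBasis n - ratBasis (n + 1) - ratBasis (n - 1)) := by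
  rw [weightMul_eq, cayleyMul_ratBasis, cayleyMul_ratBasis, add_comm 1 n, neg_add_eq_sub]

/-- D(1/(x + i)) = (i/(x + i)) · 1/(x + i), and i/(x + i) = (1 - c)/2. -/
theorem hasD_ratBasis_zero :
    HasD (ratBasis 0) ((1 / 2 : ℂ) • (ratBasis 0 - ratBasis 1)) := by
  have h := isFourierPair_expKernel.hasD_toLp isFourierPair_mul_expKernel
  rw [ratBasis_zero]
  convert h using 1
  rw [← mulL2_toLp (p := Complex.I • invAddI) (q := invAddI)
      isFourierPair_expKernel.memLp_right
    isFourierPair_mul_expKernel.memLp_right (smul_mul_assoc _ _ _), I_smul_invAddI,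
    mulL2_smul, mulL2_sub, mulL2_one, ratBasis, cayleyMul, zpow_one]

theorem hasD_ratBasis (n : ℤ) :
    HasD (ratBasis n) ((1 / 2 : ℂ) • ((n + 1 : ℂ) • (ratBasis n - ratBasis (n + 1)) +
      (n : ℂ) • (ratBasis n - ratBasis (n - 1)))) := by
  have h := hasD_cayleyMul hasD_ratBasis_zero n
  rw [cayleyMul_ratBasis, add_zero, weightMul_ratBasis, map_smul, map_sub, cayleyMul_ratBasis,
    cayleyMul_ratBasis, add_zero] at h
  convert h using 1
  module

theorem ratBasis_mem_H1 (n : ℤ) : ratBasis n ∈ H1 := (hasD_ratBasis n).mem_H1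

/-! ### The potential and the integral operator -/

theorem potentialOp_eq (m : ℕ) (f : L2) : potentialOp m f = (2 * m : ℂ) • weightMul f := by
  apply Lp.ext
  filter_upwards [(memLp_potential_mul m f).coeFn_toLp, coeFn_mulL2 (invAddI * star invAddI) f,
    Lp.coeFn_smul (2 * m : ℂ) (weightMul f)] with x h1 h2 h3
  change ((memLp_potential_mul m f).toLp _ : L2) x = _
  rw [h1, h3, Pi.smul_apply, weightMul, h2, invAddI_mul_star_apply, potential]
  push_cast
  simp only [smul_eq_mul]
  ring

/-! ### `R` as a finite sum of rank-one operators -/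

theorem cayley_zpow_apply (n : ℤ) (x : ℝ) :
    ((cayley ^ n : (ℝ →ᵇ ℂ)ˣ) : ℝ →ᵇ ℂ) x = (((x : ℂ) - Complex.I) / ((x : ℂ) + Complex.I)) ^ n := by
  let ev : (ℝ →ᵇ ℂ) →* ℂ :=
    { toFun := fun f => f x, map_one' := rfl, map_mul' := fun _ _ => rfl }
  have h : ev ((cayley ^ n : (ℝ →ᵇ ℂ)ˣ) : ℝ →ᵇ ℂ) = ((Units.map ev cayley) ^ n : ℂˣ) := by
    rw [← map_zpow, Units.coe_map]
  change ev _ = _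
  rw [h, Units.val_zpow_eq_zpow_val, Units.coe_map, ← cayley_apply]
  rfl

/-- The function `((x - i)/(x + i))^d / (1 + x²)`. -/
def weightVec (d : ℤ) : L2 := mulL2 (star invAddI) (ratBasis d)

/-- Follows from c^{-1} - 1 = 2i/(x - i). -/
theorem weightVec_eq (d : ℤ) :
    weightVec d = (-(Complex.I / 2)) • (ratBasis (d - 1) - ratBasis d) := by
  have h := cayleyMul_neg_one (ratBasis d)
  rw [cayleyMul_ratBasis, neg_add_eq_sub] at h
  rw [h, add_sub_cancel_left, smul_smul, weightVec]
  have h1 : -(Complex.I / 2) * (2 * Complex.I) = 1 := by linear_combination -Complex.I_sq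
  rw [h1, one_smul]

theorem coeFn_weightVec (d : ℤ) : weightVec d =ᵐ[volume] fun x : ℝ =>
    (((x : ℂ) - Complex.I) / ((x : ℂ) + Complex.I)) ^ d * (((1 + x ^ 2)⁻¹ : ℝ) : ℂ) := by
  have h := isFourierPair_expKernel.memLp_right
  filter_upwards [coeFn_mulL2 (star invAddI) (ratBasis d),
    coeFn_mulL2 ((cayley ^ d : (ℝ →ᵇ ℂ)ˣ) : ℝ →ᵇ ℂ) (h.toLp invAddI), h.coeFn_toLp] with x h1 h2 h3
  rw [weightVec, h1, ratBasis, cayleyMul, h2, h3, cayley_zpow_apply, ← invAddI_mul_star_apply,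
    BoundedContinuousFunction.mul_apply]
  ring

theorem cayley_arg_norm (x : ℝ) : ‖((x : ℂ) - Complex.I) / ((x : ℂ) + Complex.I)‖ = 1 := by
  have h := norm_cayley x
  rwa [norm_mul, Complex.norm_I, one_mul] at h

/-- Factor a^m - b^m = (a - b) Σ a^j b^{m-1-j}. The squared modulus of a - b cancels |x - y|² and
leaves the two weights; that of the sum expands into powers j - k. The diagonal is excluded because
the quotient 0/0 takes the value 0 there, while the sum is positive for m ≥ 1. -/
theorem kernelR_eq_sum (m : ℕ) {x y : ℝ} (hxy : x ≠ y) :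
    (kernelR m x y : ℂ) = (2 / Real.pi : ℂ) * ∑ j ∈ Finset.range m, ∑ k ∈ Finset.range m,
      ((((x : ℂ) - Complex.I) / ((x : ℂ) + Complex.I)) ^ ((j : ℤ) - k) *
        (((1 + x ^ 2)⁻¹ : ℝ) : ℂ)) *
      conj ((((y : ℂ) - Complex.I) / ((y : ℂ) + Complex.I)) ^ ((j : ℤ) - k) *
        (((1 + y ^ 2)⁻¹ : ℝ) : ℂ)) := by
  have hsub := norm_cayley_sub_sq x y
  have ha := norm_cayley x
  have hb := norm_cayley y
  have ha' := cayley_arg_norm x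
  have hb' := cayley_arg_norm y
  rw [kernelR_eq]
  set A := ((x : ℂ) - Complex.I) / ((x : ℂ) + Complex.I) with hA
  set B := ((y : ℂ) - Complex.I) / ((y : ℂ) + Complex.I) with hB
  have hA0 : A ≠ 0 := norm_ne_zero_iff.1 (by rw [ha']; exact one_ne_zero)
  have hB0 : B ≠ 0 := norm_ne_zero_iff.1 (by rw [hb']; exact one_ne_zero)
  have hI := Complex.I_ne_zero
  rw [← geom_sum₂_mul (Complex.I * A) (Complex.I * B) m, norm_mul, mul_pow, hsub]
  -- All factors are unimodular, so conjugates are inverses; the powers of i cancel and only the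
  -- difference j - k survives.
  have hS : ((‖∑ i ∈ Finset.range m, (Complex.I * A) ^ i * (Complex.I * B) ^ (m - 1 - i)‖ ^ 2 : ℝ) : ℂ)
      = ∑ j ∈ Finset.range m, ∑ k ∈ Finset.range m, A ^ ((j : ℤ) - k) * conj (B ^ ((j : ℤ) - k)) := by
    rw [Complex.ofReal_pow, ← Complex.mul_conj', map_sum, Finset.sum_mul_sum]
    refine Finset.sum_congr rfl fun j hj => Finset.sum_congr rfl fun k hk => ?_
    have hj' : j ≤ m - 1 := by have := Finset.mem_range.1 hj; omega
    have hk' : k ≤ m - 1 := by have := Finset.mem_range.1 hk; omega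
    rw [map_mul, map_pow, map_pow, ← Complex.inv_eq_conj ha, ← Complex.inv_eq_conj hb, map_zpow₀,
      ← Complex.inv_eq_conj hb', ← zpow_natCast, ← zpow_natCast, ← zpow_natCast, ← zpow_natCast,
      Nat.cast_sub hj', Nat.cast_sub hk', inv_zpow, inv_zpow, inv_zpow, ← zpow_neg, ← zpow_neg,
      ← zpow_neg, mul_mul_mul_comm, ← zpow_add₀ (mul_ne_zero hI hA0),
      ← zpow_add₀ (mul_ne_zero hI hB0), mul_zpow, mul_zpow, mul_mul_mul_comm, ← zpow_add₀ hI]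
    have e1 : (j : ℤ) + -(k : ℤ) + (((m - 1 : ℕ) : ℤ) - j + -(((m - 1 : ℕ) : ℤ) - k)) = 0 := by ring
    have e2 : (((m - 1 : ℕ) : ℤ) - j + -(((m - 1 : ℕ) : ℤ) - k)) = -((j : ℤ) - k) := by ring
    rw [e1, zpow_zero, one_mul, e2, sub_eq_add_neg]
  have hd : ((|x - y| : ℝ) : ℂ) ≠ 0 :=
    Complex.ofReal_ne_zero.2 (abs_ne_zero.2 (sub_ne_zero.mpr hxy))
  have hπ : (Real.pi : ℂ) ≠ 0 := Complex.ofReal_ne_zero.2 Real.pi_ne_zero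
  calc _ = (2 / Real.pi : ℂ) * (((‖∑ i ∈ Finset.range m, (Complex.I * A) ^ i *
        (Complex.I * B) ^ (m - 1 - i)‖ ^ 2 : ℝ) : ℂ) * ((((1 + x ^ 2)⁻¹ : ℝ) : ℂ) *
          (((1 + y ^ 2)⁻¹ : ℝ) : ℂ))) := by
        generalize ‖∑ i ∈ Finset.range m, (Complex.I * A) ^ i *
          (Complex.I * B) ^ (m - 1 - i)‖ = S
        generalize (1 + x ^ 2)⁻¹ = X
        generalize (1 + y ^ 2)⁻¹ = Y
        push_cast
        field_simp
        ring
    _ = _ := by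
        rw [hS, Finset.sum_mul]
        congr 1
        refine Finset.sum_congr rfl fun j _ => ?_
        rw [Finset.sum_mul]
        refine Finset.sum_congr rfl fun k _ => ?_
        rw [map_mul, Complex.conj_ofReal]
        ring

theorem opR_eq_sum (m : ℕ) (f : L2) :
    opR m f = (2 / Real.pi : ℂ) • ∑ j ∈ Finset.range m, ∑ k ∈ Finset.range m,
      inner ℂ (weightVec ((j : ℤ) - k)) f • weightVec ((j : ℤ) - k) := by
  apply Lp.ext
  have hv : ∀ᵐ x : ℝ, ∀ d : ℤ, weightVec d x =
      (((x : ℂ) - Complex.I) / ((x : ℂ) + Complex.I)) ^ d * (((1 + x ^ 2)⁻¹ : ℝ) : ℂ) :=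
    ae_all_iff.2 coeFn_weightVec
  have hs : ∀ᵐ x : ℝ, ∀ j k : ℕ, (inner ℂ (weightVec ((j : ℤ) - k)) f • weightVec ((j : ℤ) - k) : L2) x =
      inner ℂ (weightVec ((j : ℤ) - k)) f * weightVec ((j : ℤ) - k) x :=
    ae_all_iff.2 fun j => ae_all_iff.2 fun k => Lp.coeFn_smul _ _
  have hs1 : ∀ᵐ x : ℝ, ∀ j : ℕ, (∑ k ∈ Finset.range m,
      inner ℂ (weightVec ((j : ℤ) - k)) f • weightVec ((j : ℤ) - k) : L2) x =
      ∑ k ∈ Finset.range m, (inner ℂ (weightVec ((j : ℤ) - k)) f • weightVec ((j : ℤ) - k) : L2) x :=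
    ae_all_iff.2 fun j => by
      filter_upwards [Lp.coeFn_finsetSum (Finset.range m)
        (fun k : ℕ => (inner ℂ (weightVec ((j : ℤ) - k)) f • weightVec ((j : ℤ) - k) : L2))] with x hx
      rw [hx, Finset.sum_apply]
  have hs2 := Lp.coeFn_finsetSum (Finset.range m) (fun j : ℕ => (∑ k ∈ Finset.range m,
      inner ℂ (weightVec ((j : ℤ) - k)) f • weightVec ((j : ℤ) - k) : L2))
  filter_upwards [(memLp_kernelR m f).coeFn_toLp, hv, hs, hs1, hs2,
    Lp.coeFn_smul (2 / Real.pi : ℂ) (∑ j ∈ Finset.range m, ∑ k ∈ Finset.range m,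
      inner ℂ (weightVec ((j : ℤ) - k)) f • weightVec ((j : ℤ) - k))] with x h1 h2 h3 h4 h5 h6
  change ((memLp_kernelR m f).toLp _ : L2) x = _
  rw [h1, h6, Pi.smul_apply, h5, Finset.sum_apply]
  simp only [h4, h3]
  -- The diagonal is a null set, so the sum formula applies under the integral.
  have hne : ∀ᵐ y : ℝ, y ≠ x := by simp [ae_iff]
  have hint : ∀ d : ℤ, Integrable (fun y => conj (weightVec d y) * f y) (volume : Measure ℝ) :=
    fun d => (Lp.memLp (weightVec d)).star.integrable_mul (Lp.memLp f)
  calc _ = ∫ y, (2 / Real.pi : ℂ) * ∑ j ∈ Finset.range m, ∑ k ∈ Finset.range m,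
        weightVec ((j : ℤ) - k) x * (conj (weightVec ((j : ℤ) - k) y) * f y) := by
        refine integral_congr_ae ?_
        filter_upwards [hv, hne] with y hy hy'
        rw [kernelR_eq_sum m hy'.symm, mul_assoc, Finset.sum_mul]
        simp only [Finset.sum_mul, hy, h2, mul_assoc]
    _ = _ := by
        rw [integral_const_mul, smul_eq_mul, integral_finsetSum _ fun j _ =>
          integrable_finsetSum _ fun k _ => (hint _).const_mul _]
        congr 1
        refine Finset.sum_congr rfl fun j _ => ?_
        rw [integral_finsetSum _ fun k _ => (hint _).const_mul _]
        refine Finset.sum_congr rfl fun k _ => ?_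
        rw [integral_const_mul, L2.inner_def, mul_comm]
        congr 1
        refine integral_congr_ae (Eventually.of_forall fun y => ?_)
        simp only [RCLike.inner_apply]
        ring

/-- The vectors making up R involve only e_n with -m ≤ n < m, and c^{-m} e_n lies in H₋ for n < m,
hence is orthogonal to f. -/
theorem opR_eq_zero_of_hardy_one (m : ℕ) {f : L2} (hf : f ∈ hardy 1) :
    opR m (cayleyMul m f) = 0 := by
  rw [opR_eq_sum, Finset.sum_eq_zero, smul_zero]
  intro j hj
  refine Finset.sum_eq_zero fun k _ => ?_
  have hj' := Finset.mem_range.1 hj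
  have h (n : ℤ) (hn : n < m) : inner ℂ (ratBasis n) (cayleyMul m f) = 0 := by
    rw [← cayleyMul_cayleyMul_neg m (ratBasis n), inner_cayleyMul_left, cayleyMul_neg_cayleyMul,
      cayleyMul_ratBasis]
    exact inner_eq_zero_of_hardy (ratBasis_mem_hardy_neg_one (by linarith)) hf
  rw [weightVec_eq, inner_smul_left, inner_sub_left, h _ (by omega), h _ (by omega), sub_zero,
    mul_zero, zero_smul]

theorem opR_eq_zero_of_hardy_neg_one (m : ℕ) {f : L2} (hf : f ∈ hardy (-1)) :
    opR m (cayleyMul (-m) f) = 0 := by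
  rw [opR_eq_sum, Finset.sum_eq_zero, smul_zero]
  intro j _
  refine Finset.sum_eq_zero fun k hk => ?_
  have hk' := Finset.mem_range.1 hk
  have h (n : ℤ) (hn : -m ≤ n) : inner ℂ (ratBasis n) (cayleyMul (-m) f) = 0 := by
    rw [← inner_conj_symm, inner_cayleyMul_left, neg_neg, cayleyMul_ratBasis,
      inner_eq_zero_of_hardy hf (ratBasis_mem_hardy_one (by linarith)), map_zero]
  rw [weightVec_eq, inner_smul_left, inner_sub_left, h _ (by omega), h _ (by omega), sub_zero,
    mul_zero, zero_smul]

/-- The length of a diagonal in an m × m array. The case |d| = m, of length 0, is included because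
it occurs at both ends of the span. -/
theorem sum_range_sub_eq (m : ℕ) {d : ℤ} (hd : |d| ≤ m) :
    ∑ j ∈ Finset.range m, ∑ k ∈ Finset.range m, (if (j : ℤ) - k = d then (1 : ℂ) else 0) =
      m - |d| := by
  have h1 (j : ℕ) : ∑ k ∈ Finset.range m, (if (j : ℤ) - k = d then (1 : ℂ) else 0) =
      if 0 ≤ (j : ℤ) - d ∧ (j : ℤ) - d < m then 1 else 0 := by
    split_ifs with h
    · rw [Finset.sum_eq_single ((j : ℤ) - d).toNat]
      · rw [if_pos (by omega)]
      · intro k _ hk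
        rw [if_neg (by omega)]
      · intro hk
        exact absurd (Finset.mem_range.2 (by omega)) hk
    · refine Finset.sum_eq_zero fun k hk => ?_
      have := Finset.mem_range.1 hk
      rw [if_neg (by omega)]
  simp only [h1]
  rw [← Finset.sum_filter, Finset.sum_const, nsmul_eq_mul, mul_one]
  have h2 : (Finset.range m).filter (fun j : ℕ => 0 ≤ (j : ℤ) - d ∧ (j : ℤ) - d < m) =
      Finset.Ico (max 0 d).toNat (m - (max 0 (-d)).toNat) := by
    ext j
    simp only [Finset.mem_filter, Finset.mem_range, Finset.mem_Ico]
    have := abs_le.1 hd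
    omega
  rw [h2, Nat.card_Ico]
  have h3 : ((m - (max 0 (-d)).toNat - (max 0 d).toNat : ℕ) : ℤ) = m - |d| := by
    rcases abs_cases d with ⟨h, _⟩ | ⟨h, _⟩ <;> omega
  rw [← Int.cast_natCast, h3]
  push_cast
  rfl

/-- By orthogonality only the vectors with d = n and d = n + 1 pair with e_n; they occur m - |n| and
m - |n + 1| times in the double sum. -/
theorem opR_ratBasis (m : ℕ) {n : ℤ} (h1 : |n| ≤ m) (h2 : |n + 1| ≤ m) :
    opR m (ratBasis n) = (1 / 2 : ℂ) •
      (((m : ℂ) - (|n| : ℤ)) • (ratBasis n - ratBasis (n - 1)) -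
        ((m : ℂ) - (|n + 1| : ℤ)) • (ratBasis (n + 1) - ratBasis n)) := by
  have hπ : (Real.pi : ℂ) ≠ 0 := Complex.ofReal_ne_zero.2 Real.pi_ne_zero
  have hin (d : ℤ) : inner ℂ (weightVec d) (ratBasis n) • weightVec d =
      (if d = n + 1 then (1 : ℂ) else 0) • ((Complex.I / 2 * Real.pi) • weightVec (n + 1)) -
      (if d = n then (1 : ℂ) else 0) • ((Complex.I / 2 * Real.pi) • weightVec n) := by
    have h : inner ℂ (weightVec d) (ratBasis n) =
        Complex.I / 2 * ((if d - 1 = n then (Real.pi : ℂ) else 0) -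
          (if d = n then (Real.pi : ℂ) else 0)) := by
      rw [weightVec_eq, inner_smul_left, inner_sub_left, inner_ratBasis, inner_ratBasis]
      simp [map_ofNat]
      ring
    rw [h]
    by_cases e1 : d = n
    · rw [if_pos e1, if_pos e1, if_neg (show ¬ d - 1 = n by omega),
        if_neg (show ¬ d = n + 1 by omega), e1]
      module
    · by_cases e2 : d = n + 1
      · rw [if_neg e1, if_neg e1, if_pos (show d - 1 = n by omega), if_pos e2, e2]
        module
      · rw [if_neg e1, if_neg e1, if_neg (show ¬ d - 1 = n by omega), if_neg e2]
        module
  rw [opR_eq_sum]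
  simp only [hin, Finset.sum_sub_distrib, ← Finset.sum_smul]
  rw [sum_range_sub_eq m h1, sum_range_sub_eq m h2, weightVec_eq, weightVec_eq,
    add_sub_cancel_right]
  simp only [smul_sub, smul_smul]
  have e (a : ℂ) : 2 / Real.pi * (a * (Complex.I / 2 * Real.pi * -(Complex.I / 2))) = 1 / 2 * a := by
    field_simp
    linear_combination -a * Complex.I_sq
  simp only [e]
  module

/-! ### The operators on the rational basis -/

/-- `L₊` as a linear map on `H¹(ℝ)`. -/
def lplus (m : ℕ) : H1 →ₗ[ℂ] L2 := (Lplus m).toFun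

/-- `L₋` as a linear map on `H¹(ℝ)`. -/
def lminus (m : ℕ) : H1 →ₗ[ℂ] L2 := (Lminus m).toFun

theorem Lplus_eq (m : ℕ) : Lplus m = ⟨H1, lplus m⟩ := rfl

theorem Lminus_eq (m : ℕ) : Lminus m = ⟨H1, lminus m⟩ := rfl

theorem lplus_apply (m : ℕ) (u : H1) :
    lplus m u = absNabla u - (2 * m : ℂ) • weightMul (u : L2) := by
  rw [← potentialOp_eq]
  rfl

theorem lminus_apply (m : ℕ) (u : H1) :
    lminus m u = lplus m u + opR m (u : L2) := rfl

/-- c^m f stays in H₊, where |∇| = D, and the derivative of c^m contributes exactly the potential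
with the opposite sign. -/
theorem lplus_cayleyMul (m : ℕ) {f g : L2} (h : HasD f g) (hf : f ∈ hardy 1)
    (u : H1) (hu : (u : L2) = cayleyMul m f) : lplus m u = cayleyMul m g := by
  have h1 := hasD_cayleyMul h m
  rw [← hu] at h1
  have h2 : (u : L2) ∈ hardy 1 := hu ▸ cayleyMul_mem_hardy_one (by positivity) hf
  rw [lplus_apply, absNabla_of_hardy (σ := 1) (by norm_num) h1 h2]
  push_cast
  module

theorem lplus_cayleyMul_neg (m : ℕ) {f g : L2} (h : HasD f g) (hf : f ∈ hardy (-1))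
    (u : H1) (hu : (u : L2) = cayleyMul (-m) f) :
    lplus m u = -cayleyMul (-m) g := by
  have h1 := hasD_cayleyMul h (-m)
  rw [← hu] at h1
  have h2 : (u : L2) ∈ hardy (-1) := hu ▸ cayleyMul_mem_hardy_neg_one (by simp) hf
  rw [lplus_apply, absNabla_of_hardy (σ := -1) (by norm_num) h1 h2]
  push_cast
  module

/-- Half a path Laplacian with weight m - |n| on the edge from n - 1 to n. The weights at n = ±m
vanish, which decouples the indices in [-m, m) from the others. -/
theorem lplus_ratBasis (m : ℕ) (n : ℤ) :
    lplus m ⟨ratBasis n, ratBasis_mem_H1 n⟩ = (1 / 2 : ℂ) •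
      (((m : ℂ) - (|n + 1| : ℤ)) • (ratBasis (n + 1) - ratBasis n) -
        ((m : ℂ) - (|n| : ℤ)) • (ratBasis n - ratBasis (n - 1))) := by
  rw [lplus_apply]
  simp only [weightMul_ratBasis]
  rcases le_or_gt 0 n with hn | hn
  · rw [absNabla_of_hardy (f := ⟨ratBasis n, ratBasis_mem_H1 n⟩) (σ := 1) (by norm_num) (hasD_ratBasis n) (ratBasis_mem_hardy_one hn),
      abs_of_nonneg hn, abs_of_nonneg (by omega)]
    push_cast
    module
  · rw [absNabla_of_hardy (f := ⟨ratBasis n, ratBasis_mem_H1 n⟩) (σ := -1) (by norm_num) (hasD_ratBasis n)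
      (ratBasis_mem_hardy_neg_one hn), abs_of_neg hn, abs_of_nonpos (by omega)]
    push_cast
    module

theorem lminus_ratBasis (m : ℕ) {n : ℤ} (h1 : -m ≤ n) (h2 : n < m) :
    lminus m ⟨ratBasis n, ratBasis_mem_H1 n⟩ = 0 := by
  rw [lminus_apply, lplus_ratBasis, opR_ratBasis m (abs_le.2 ⟨by omega, by omega⟩)
    (abs_le.2 ⟨by omega, by omega⟩)]
  module

/-! ### Symmetry -/

theorem opR_symmetric (m : ℕ) (f g : L2) : inner ℂ (opR m f) g = inner ℂ f (opR m g) := by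
  rw [opR_eq_sum, opR_eq_sum, inner_smul_left, inner_smul_right, sum_inner, inner_sum]
  congr 1
  · simp [map_ofNat]
  refine Finset.sum_congr rfl fun j _ => ?_
  rw [sum_inner, inner_sum]
  refine Finset.sum_congr rfl fun k _ => ?_
  rw [inner_smul_left, inner_smul_right, inner_conj_symm]
  ring

theorem lplus_symmetric (m : ℕ) (u v : H1) :
    inner ℂ (lplus m u) (v : L2) = inner ℂ (u : L2) (lplus m v) := by
  have h : star (invAddI * star invAddI) = invAddI * star invAddI := by
    rw [star_mul, star_star]
  rw [lplus_apply, lplus_apply, inner_sub_left, inner_sub_right, absNabla_symmetric,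
    inner_smul_left, inner_smul_right, weightMul, inner_mulL2_left, h]
  simp [map_ofNat]

theorem lminus_symmetric (m : ℕ) (u v : H1) :
    inner ℂ (lminus m u) (v : L2) = inner ℂ (u : L2) (lminus m v) := by
  rw [lminus_apply, lminus_apply, inner_add_left, inner_add_right, lplus_symmetric, opR_symmetric]

/-! ### The model space of the Cayley transform -/

/-- Orthogonality to e_0 says that g vanishes at i, so division by c creates no pole. In
frequencies: for ξ < 0 the exponential kernel factors, and the convolution with the transform of
1/(x - i) is e^{2πξ} times a pairing of e_0 with g. -/
theorem cayleyMul_neg_one_mem_hardy {g : L2} (hg : g ∈ hardy 1)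
    (h0 : inner ℂ (ratBasis 0) g = 0) : cayleyMul (-1) g ∈ hardy 1 := by
  rw [cayleyMul_neg_one]
  refine add_mem hg (Submodule.smul_mem _ _ ?_)
  filter_upwards [isFourierPair_expKernel.star.fourier_mulL2 g] with ξ hξ hneg
  have hξ0 : ξ < 0 := by linarith
  rw [inner_eq_fourier] at h0
  rw [hξ]
  have hne : ∀ᵐ η : ℝ, η ≠ 0 := by simp [ae_iff]
  have hb : ((𝓕 (ratBasis 0) : L2) : ℝ → ℂ) =ᵐ[volume] expKernel := by
    rw [ratBasis_zero, isFourierPair_expKernel.fourier_toLp]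
    exact isFourierPair_expKernel.memLp.coeFn_toLp
  calc _ = ∫ η, (Real.exp (2 * Real.pi * ξ) : ℂ) * (conj ((𝓕 (ratBasis 0) : L2) η) * (𝓕 g : L2) η) := by
        refine integral_congr_ae ?_
        filter_upwards [hg, hne, hb] with η h1 h2 h3
        rcases lt_or_gt_of_ne h2 with h | h
        · simp [h1 (by linarith)]
        · rw [h3, expKernel_of_pos (by linarith), expKernel_of_pos h]
          have : Real.exp (-2 * Real.pi * -(ξ - η)) =
              Real.exp (2 * Real.pi * ξ) * Real.exp (-2 * Real.pi * η) := by
            rw [← Real.exp_add]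
            congr 1
            ring
          rw [this]
          simp only [map_mul, Complex.conj_ofReal, Complex.ofReal_mul]
          ring
    _ = 0 := by rw [integral_const_mul, h0, mul_zero]

theorem exists_eq_smul_add_cayleyMul {h : L2} (hh : h ∈ hardy 1) :
    ∃ c : ℂ, ∃ g ∈ hardy 1, h = c • ratBasis 0 + cayleyMul 1 g := by
  have hπ : (Real.pi : ℂ) ≠ 0 := Complex.ofReal_ne_zero.2 Real.pi_ne_zero
  set c : ℂ := inner ℂ (ratBasis 0) h / Real.pi with hc
  refine ⟨c, cayleyMul (-1) (h - c • ratBasis 0), cayleyMul_neg_one_mem_hardy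
    (sub_mem hh (Submodule.smul_mem _ _ (ratBasis_mem_hardy_one le_rfl))) ?_, ?_⟩
  · rw [inner_sub_right, inner_smul_right, inner_ratBasis_zero, hc]
    field_simp
    ring
  · rw [cayleyMul_cayleyMul_neg]
    abel

/-- Split off the e_0 component and divide the rest by c. The second condition passes from k + 1 to
k because c^{-(k+1)} e_0 = e_{-(k+1)} is itself in H₋. -/
theorem mem_span_of_hardy (k : ℕ) {h : L2} (h1 : h ∈ hardy 1)
    (h2 : cayleyMul (-k) h ∈ hardy (-1)) :
    h ∈ Submodule.span ℂ (ratBasis '' Set.Ico 0 (k : ℤ)) := by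
  induction k generalizing h with
  | zero =>
    rw [Nat.cast_zero, neg_zero, cayleyMul_zero] at h2
    rw [eq_zero_of_hardy h2 h1]
    exact zero_mem _
  | succ k ih =>
    obtain ⟨c, g, hg, rfl⟩ := exists_eq_smul_add_cayleyMul h1
    have h3 : cayleyMul (-k) g ∈ hardy (-1) := by
      have h4 : cayleyMul (-((k + 1 : ℕ) : ℤ)) (c • ratBasis 0 + cayleyMul 1 g) =
          c • ratBasis (-((k + 1 : ℕ) : ℤ)) + cayleyMul (-k) g := by
        rw [map_add, map_smul, cayleyMul_ratBasis, ← cayleyMul_add, add_zero]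
        congr 3
        push_cast
        ring
      rw [h4] at h2
      have h5 := sub_mem h2 (Submodule.smul_mem _ c (ratBasis_mem_hardy_neg_one
        (n := -((k + 1 : ℕ) : ℤ)) (by omega)))
      rwa [add_sub_cancel_left] at h5
    refine add_mem (Submodule.smul_mem _ _ (Submodule.subset_span ⟨0, by simp, rfl⟩)) ?_
    have h6 := Submodule.mem_map_of_mem (f := (cayleyMul 1 : L2 →ₗ[ℂ] L2)) (ih hg h3)
    rw [Submodule.map_span] at h6
    refine Submodule.span_mono ?_ h6
    rintro _ ⟨_, ⟨n, hn, rfl⟩, rfl⟩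
    refine ⟨1 + n, ⟨by have := hn.1; omega, by have := hn.2; push_cast; omega⟩, ?_⟩
    exact (cayleyMul_ratBasis 1 n).symm

/-- The span of the basis functions with index in `[-m, m)`. -/
def ratSpan (m : ℕ) : Submodule ℂ L2 :=
  Submodule.span ℂ (ratBasis '' Set.Ico (-(m : ℤ)) m)

/-- Multiplication by c^m shifts the index range [-m, m) to [0, 2m), where the one-sided statement
applies. -/
theorem mem_ratSpan_of_hardy (m : ℕ) {f : L2} (h1 : cayleyMul m f ∈ hardy 1)
    (h2 : cayleyMul (-m) f ∈ hardy (-1)) : f ∈ ratSpan m := by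
  have h3 : cayleyMul (-((2 * m : ℕ) : ℤ)) (cayleyMul m f) ∈ hardy (-1) := by
    rw [← cayleyMul_add]
    convert h2 using 3
    push_cast
    ring
  have h6 := Submodule.mem_map_of_mem (f := (cayleyMul (-m) : L2 →ₗ[ℂ] L2))
    (mem_span_of_hardy (2 * m) h1 h3)
  rw [Submodule.map_span, ContinuousLinearMap.coe_coe, cayleyMul_neg_cayleyMul] at h6
  refine Submodule.span_mono ?_ h6
  rintro _ ⟨_, ⟨n, hn, rfl⟩, rfl⟩
  refine ⟨-m + n, ⟨by have := hn.1; omega, by have := hn.2; push_cast at this; omega⟩, ?_⟩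
  exact (cayleyMul_ratBasis (-m) n).symm

/-! ### Eigenfunctions -/

/-- A weak form of "D has no eigenvectors": the hypothesis says that (2πξ - z) ĝ(ξ) annihilates
every admissible transform supported on σξ ≥ 0, so ĝ vanishes for σξ > 0. Nothing is assumed about z
being real. -/
theorem mem_hardy_of_forall_inner {σ : ℝ} {g : L2} {z : ℂ}
    (h : ∀ f f' : L2, f ∈ hardy σ → HasD f f' → inner ℂ f' g = z * inner ℂ f g) :
    g ∈ hardy (-σ) := by
  have key (N : ℕ) : ∀ᵐ ξ : ℝ, 0 < σ * ξ → |ξ| ≤ N → (𝓕 g : L2) ξ = 0 := by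
    set S : Set ℝ := {ξ | 0 < σ * ξ ∧ |ξ| ≤ N} with hS
    have hSm : MeasurableSet S := by
      exact (measurableSet_lt measurable_const (measurable_const_mul σ)).inter
        (measurableSet_le continuous_abs.measurable measurable_const)
    -- Test with (2πξ - z) ĝ itself, so that the hypothesis becomes ‖F‖² = 0. The cutoff |ξ| ≤ N
    -- keeps both F and ξF square integrable.
    set F : ℝ → ℂ := S.indicator fun ξ => (2 * Real.pi * ξ - z) * (𝓕 g : L2) ξ with hF
    have hFm : AEStronglyMeasurable F (volume : Measure ℝ) := by
      refine AEStronglyMeasurable.indicator ?_ hSm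
      exact (Continuous.aestronglyMeasurable (by fun_prop)).mul (Lp.aestronglyMeasurable _)
    have hFL : MemLp F 2 (volume : Measure ℝ) := by
      refine MemLp.of_le_mul (c := 2 * Real.pi * N + ‖z‖) (Lp.memLp (𝓕 g : L2)) hFm
        (Eventually.of_forall fun ξ => ?_)
      by_cases hξ : ξ ∈ S
      · rw [hF, Set.indicator_of_mem hξ, norm_mul]
        refine mul_le_mul_of_nonneg_right ((norm_sub_le _ _).trans ?_) (norm_nonneg _)
        rw [norm_mul, norm_mul, Complex.norm_real, Complex.norm_real, Complex.norm_ofNat,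
          Real.norm_of_nonneg Real.pi_pos.le]
        have := hξ.2
        gcongr
        exact this
      · rw [hF, Set.indicator_of_notMem hξ, norm_zero]
        positivity
    have hFL' : MemLp (fun ξ => ((2 * Real.pi * ξ : ℝ) : ℂ) * F ξ) 2 (volume : Measure ℝ) := by
      refine MemLp.of_le_mul (c := 2 * Real.pi * N) hFL ?_ (Eventually.of_forall fun ξ => ?_)
      · exact (Continuous.aestronglyMeasurable (by fun_prop)).mul hFm
      by_cases hξ : ξ ∈ S
      · rw [norm_mul]
        refine mul_le_mul_of_nonneg_right ?_ (norm_nonneg _)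
        rw [Complex.norm_real, norm_mul, Real.norm_of_nonneg (by positivity)]
        have := hξ.2
        gcongr
        exact this
      · rw [hF, Set.indicator_of_notMem hξ, mul_zero, norm_zero, mul_zero]
    have e1 : ((𝓕 (𝓕⁻ (hFL.toLp F) : L2) : L2) : ℝ → ℂ) =ᵐ[volume] F := by
      rw [fourier_fourierInv_eq]
      exact hFL.coeFn_toLp
    have e2 : ((𝓕 (𝓕⁻ (hFL'.toLp _) : L2) : L2) : ℝ → ℂ) =ᵐ[volume]
        fun ξ => ((2 * Real.pi * ξ : ℝ) : ℂ) * F ξ := by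
      rw [fourier_fourierInv_eq]
      exact hFL'.coeFn_toLp
    have hh : (𝓕⁻ (hFL.toLp F) : L2) ∈ hardy σ := by
      filter_upwards [e1] with ξ h1 h2
      rw [h1, hF, Set.indicator_of_notMem fun h3 => lt_asymm h2 h3.1]
    have hD : HasD (𝓕⁻ (hFL.toLp F) : L2) (𝓕⁻ (hFL'.toLp _) : L2) := by
      filter_upwards [e1, e2] with ξ h1 h2
      rw [h1, h2]
    have h0 := sub_eq_zero.2 (h _ _ hh hD)
    have h1 : inner ℂ (𝓕⁻ (hFL'.toLp _) : L2) g - z * inner ℂ (𝓕⁻ (hFL.toLp F) : L2) g =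
        inner ℂ (𝓕⁻ (hFL.toLp F) : L2) (𝓕⁻ (hFL.toLp F) : L2) := by
      rw [inner_eq_fourier, inner_eq_fourier, inner_eq_fourier, ← integral_const_mul,
        ← integral_sub]
      · refine integral_congr_ae ?_
        filter_upwards [e1, e2] with ξ h1 h2
        rw [h1, h2]
        by_cases hξ : ξ ∈ S
        · rw [hF, Set.indicator_of_mem hξ, map_mul, Complex.conj_ofReal]
          push_cast
          ring
        · rw [hF, Set.indicator_of_notMem hξ]
          simp
      · exact (Lp.memLp (𝓕 (𝓕⁻ (hFL'.toLp _) : L2) : L2)).star.integrable_mul (Lp.memLp (𝓕 g : L2))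
      · exact ((Lp.memLp (𝓕 (𝓕⁻ (hFL.toLp F) : L2) : L2)).star.integrable_mul
          (Lp.memLp (𝓕 g : L2))).const_mul z
    rw [h1, inner_self_eq_zero] at h0
    have e3 : F =ᵐ[volume] fun _ => 0 := by
      rw [h0] at e1
      exact e1.symm.trans coeFn_fourier_zero
    -- The factor 2πξ - z can vanish at this one point only.
    have hne : ∀ᵐ ξ : ℝ, ξ ≠ z.re / (2 * Real.pi) := by simp [ae_iff]
    filter_upwards [e3, hne] with ξ h2 h3 h4 h5
    rw [hF, Set.indicator_of_mem (show ξ ∈ S from ⟨h4, h5⟩)] at h2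
    refine (mul_eq_zero.1 h2).resolve_left fun h6 => h3 ?_
    have h7 := congrArg Complex.re h6
    simp at h7
    rw [eq_div_iff (by positivity)]
    linarith
  filter_upwards [ae_all_iff.2 key] with ξ hξ hneg
  obtain ⟨N, hN⟩ := exists_nat_ge |ξ|
  exact hξ N (by linarith) hN

/-- Stated for any symmetric A acting as ±D on the two shifted Hardy spaces, so that it serves L₊
and L₋ alike. Pairing the eigenvector u with c^m f and c^{-m} f turns the eigenvalue equation into a
weak equation for D on c^{-m} u and c^m u. -/
theorem mem_ratSpan_of_eigenvector {m : ℕ} {A : H1 →ₗ[ℂ] L2}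
    (hA : ∀ u v : H1, inner ℂ (A u) (v : L2) = inner ℂ (u : L2) (A v))
    (h1 : ∀ (f g : L2) (u : H1), HasD f g → f ∈ hardy 1 → (u : L2) = cayleyMul m f →
      A u = cayleyMul m g)
    (h2 : ∀ (f g : L2) (u : H1), HasD f g → f ∈ hardy (-1) → (u : L2) = cayleyMul (-m) f →
      A u = -cayleyMul (-m) g) {u : H1} {z : ℂ} (hu : A u = z • (u : L2)) :
    (u : L2) ∈ ratSpan m := by
  apply mem_ratSpan_of_hardy
  · rw [← neg_neg (1 : ℝ)]
    -- The sign comes from |∇| = -D on H₋.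
    refine mem_hardy_of_forall_inner (z := -z) fun f g hf hD => ?_
    have h3 := hA ⟨cayleyMul (-m) f, (hasD_cayleyMul hD (-m)).mem_H1⟩ u
    rw [h2 f g _ hD hf rfl, hu, inner_neg_left, inner_smul_right, inner_cayleyMul_left,
      inner_cayleyMul_left, neg_neg] at h3
    linear_combination -h3
  · refine mem_hardy_of_forall_inner (z := z) fun f g hf hD => ?_
    have h3 := hA ⟨cayleyMul m f, (hasD_cayleyMul hD m).mem_H1⟩ u
    rw [h1 f g _ hD hf rfl, hu, inner_smul_right, inner_cayleyMul_left,
      inner_cayleyMul_left] at h3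
    exact h3

theorem mem_ratSpan_of_lplus_eq {m : ℕ} {u : H1} {z : ℂ} (hu : lplus m u = z • (u : L2)) :
    (u : L2) ∈ ratSpan m :=
  mem_ratSpan_of_eigenvector (lplus_symmetric m)
    (fun _ _ _ hD hf h => lplus_cayleyMul m hD hf _ h)
    (fun _ _ _ hD hf h => lplus_cayleyMul_neg m hD hf _ h) hu

theorem mem_ratSpan_of_lminus_eq {m : ℕ} {u : H1} {z : ℂ} (hu : lminus m u = z • (u : L2)) :
    (u : L2) ∈ ratSpan m :=
  mem_ratSpan_of_eigenvector (lminus_symmetric m)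
    (fun _ _ _ hD hf h => by
      rw [lminus_apply, lplus_cayleyMul m hD hf _ h, h, opR_eq_zero_of_hardy_one m hf, add_zero])
    (fun _ _ _ hD hf h => by
      rw [lminus_apply, lplus_cayleyMul_neg m hD hf _ h, h, opR_eq_zero_of_hardy_neg_one m hf,
        add_zero]) hu

/-! ### The point spectrum -/

theorem linearIndependent_ratBasis : LinearIndependent ℂ ratBasis := by
  refine linearIndependent_of_ne_zero_of_inner_eq_zero (fun n h => ?_) fun i j hij => ?_
  · have h1 := inner_ratBasis n n
    rw [h, inner_zero_left, if_pos rfl] at h1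
    exact Real.pi_ne_zero (Complex.ofReal_eq_zero.1 h1.symm)
  · exact (inner_ratBasis i j).trans (if_neg hij)

theorem finrank_ratSpan (m : ℕ) : Module.finrank ℂ (ratSpan m) = 2 * m := by
  have h := finrank_span_eq_card (R := ℂ) (linearIndependent_ratBasis.comp
    (Subtype.val : Set.Ico (-(m : ℤ)) m → ℤ) Subtype.val_injective)
  rw [ratSpan, Set.image_eq_range]
  refine h.trans ?_
  have h1 := Int.card_fintype_Ico_of_le (a := -(m : ℤ)) (b := m) (by omega)
  have h2 : Fintype.card {x // x ∈ Set.Ico (-(m : ℤ)) m} = Fintype.card (Set.Ico (-(m : ℤ)) m) :=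
    rfl
  omega

instance finiteDimensional_ratSpan (m : ℕ) : FiniteDimensional ℂ (ratSpan m) :=
  FiniteDimensional.span_of_finite ℂ ((Set.finite_Ico _ _).image _)

theorem ratBasis_mem_ratSpan {m : ℕ} {n : ℤ} (h1 : -m ≤ n) (h2 : n < m) :
    ratBasis n ∈ ratSpan m := Submodule.subset_span ⟨n, ⟨h1, h2⟩, rfl⟩

theorem ratSpan_le_map_ker_lminus (m : ℕ) :
    ratSpan m ≤ (LinearMap.ker (lminus m)).map H1.subtype := by
  rw [ratSpan, Submodule.span_le]
  rintro _ ⟨n, hn, rfl⟩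
  exact ⟨⟨ratBasis n, ratBasis_mem_H1 n⟩, lminus_ratBasis m hn.1 hn.2, rfl⟩

theorem ratSpan_le_H1 (m : ℕ) : ratSpan m ≤ H1 :=
  (ratSpan_le_map_ker_lminus m).trans (Submodule.map_subtype_le _ _)

theorem lminus_eq_zero {m : ℕ} {u : H1} (hu : (u : L2) ∈ ratSpan m) : lminus m u = 0 := by
  obtain ⟨v, hv, hvu⟩ := ratSpan_le_map_ker_lminus m hu
  rwa [← Subtype.ext hvu]

theorem lplus_eq_neg_opR {m : ℕ} {u : H1} (hu : (u : L2) ∈ ratSpan m) :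
    lplus m u = -opR m (u : L2) := by
  have h := lminus_eq_zero hu
  rw [lminus_apply] at h
  exact eq_neg_of_add_eq_zero_left h

theorem mem_eigenspace_iff {A : H1 →ₗ[ℂ] L2} {z : ℂ} {u : H1} :
    u ∈ eigenspace ⟨H1, A⟩ z ↔ A u = z • (u : L2) := by
  change A u - z • (u : L2) = 0 ↔ _
  exact sub_eq_zero

theorem mem_pointSpectrum_iff {A : H1 →ₗ[ℂ] L2} {z : ℂ} :
    z ∈ pointSpectrum ⟨H1, A⟩ ↔ ∃ u : H1, u ≠ 0 ∧ A u = z • (u : L2) := Iff.rfl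

theorem pointSpectrum_Lminus {m : ℕ} (hm : 1 ≤ m) : pointSpectrum (Lminus m) = {0} := by
  ext z
  rw [Lminus_eq, mem_pointSpectrum_iff, Set.mem_singleton_iff]
  constructor
  · rintro ⟨u, hu, h⟩
    have h1 := lminus_eq_zero (mem_ratSpan_of_lminus_eq h)
    rw [h] at h1
    exact (smul_eq_zero.1 h1).resolve_right fun h2 => hu (Subtype.ext h2)
  · rintro rfl
    refine ⟨⟨ratBasis 0, ratBasis_mem_H1 0⟩, fun h => ?_, ?_⟩
    · exact linearIndependent_ratBasis.ne_zero 0 (congrArg Subtype.val h)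
    · rw [lminus_eq_zero (ratBasis_mem_ratSpan (by omega) (by omega)), zero_smul]

theorem finrank_eigenspace_eq_map (A : H1 →ₗ[ℂ] L2) (z : ℂ) :
    Module.finrank ℂ (eigenspace ⟨H1, A⟩ z) =
      Module.finrank ℂ ((eigenspace ⟨H1, A⟩ z).map H1.subtype) :=
  (Submodule.equivMapOfInjective H1.subtype H1.injective_subtype _).finrank_eq

theorem finrank_eigenspace_Lminus (m : ℕ) :
    Module.finrank ℂ (eigenspace (Lminus m) 0) = 2 * m := by
  have h : (eigenspace ⟨H1, lminus m⟩ 0).map H1.subtype = ratSpan m := by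
    refine le_antisymm ?_ fun u hu => ?_
    · rintro _ ⟨u, hu, rfl⟩
      exact mem_ratSpan_of_lminus_eq (mem_eigenspace_iff.1 hu)
    · refine ⟨⟨u, ratSpan_le_H1 m hu⟩, mem_eigenspace_iff.2 ?_, rfl⟩
      rw [lminus_eq_zero hu, zero_smul]
  rw [Lminus_eq, finrank_eigenspace_eq_map, h, finrank_ratSpan]

/-! ### Reduction of `L₊` to a finite matrix -/

theorem opR_mem_ratSpan (m : ℕ) (f : L2) : opR m f ∈ ratSpan m := by
  rw [opR_eq_sum]
  refine Submodule.smul_mem _ _ (Submodule.sum_mem _ fun j hj => Submodule.sum_mem _ fun k hk =>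
    Submodule.smul_mem _ _ ?_)
  have hj' := Finset.mem_range.1 hj
  have hk' := Finset.mem_range.1 hk
  rw [weightVec_eq]
  -- Here d = j - k satisfies |d| < m, so d - 1 and d both lie in [-m, m).
  exact Submodule.smul_mem _ _ (sub_mem (ratBasis_mem_ratSpan (by omega) (by omega))
    (ratBasis_mem_ratSpan (by omega) (by omega)))

/-- The restriction of `L₊` to the span of its eigenfunctions. -/
def lplusSpan (m : ℕ) : ratSpan m →ₗ[ℂ] ratSpan m :=
  -((opR m).restrict fun f _ => opR_mem_ratSpan m f)

theorem coe_lplusSpan (m : ℕ) (u : ratSpan m) : (lplusSpan m u : L2) = -opR m (u : L2) := rfl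

theorem lplusSpan_isSymmetric (m : ℕ) : (lplusSpan m).IsSymmetric := fun u v => by
  rw [Submodule.coe_inner, Submodule.coe_inner, coe_lplusSpan, coe_lplusSpan, inner_neg_left,
    inner_neg_right, opR_symmetric]

/-- Eigenfunctions of L₊ lie in V, where L₊ = -R, so the eigenvalue problem is that of a symmetric
endomorphism of V. -/
theorem map_eigenspace_Lplus (m : ℕ) (z : ℂ) :
    (eigenspace ⟨H1, lplus m⟩ z).map H1.subtype =
      (Module.End.eigenspace (lplusSpan m) z).map (ratSpan m).subtype := by
  refine le_antisymm ?_ ?_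
  · rintro _ ⟨u, hu, rfl⟩
    have hu1 := mem_eigenspace_iff.1 hu
    have hu2 := mem_ratSpan_of_lplus_eq hu1
    refine ⟨⟨u, hu2⟩, Module.End.mem_eigenspace_iff.2 (Subtype.ext ?_), rfl⟩
    rw [coe_lplusSpan, ← lplus_eq_neg_opR hu2, hu1]
    rfl
  · rintro _ ⟨u, hu, rfl⟩
    refine ⟨⟨u, ratSpan_le_H1 m u.2⟩, mem_eigenspace_iff.2 ?_, rfl⟩
    rw [lplus_eq_neg_opR u.2]
    exact congrArg Subtype.val (Module.End.mem_eigenspace_iff.1 hu)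

theorem finrank_eigenspace_Lplus (m : ℕ) (z : ℂ) :
    Module.finrank ℂ (eigenspace (Lplus m) z) =
      Module.finrank ℂ (Module.End.eigenspace (lplusSpan m) z) := by
  rw [Lplus_eq, finrank_eigenspace_eq_map, map_eigenspace_Lplus]
  exact (Submodule.equivMapOfInjective _ (ratSpan m).injective_subtype _).finrank_eq.symm

theorem mem_pointSpectrum_Lplus_iff {m : ℕ} {z : ℂ} :
    z ∈ pointSpectrum (Lplus m) ↔ Module.End.HasEigenvalue (lplusSpan m) z := by
  have h1 : z ∈ pointSpectrum (Lplus m) ↔ eigenspace ⟨H1, lplus m⟩ z ≠ ⊥ := by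
    rw [Submodule.ne_bot_iff, Lplus_eq, mem_pointSpectrum_iff]
    exact ⟨fun ⟨u, h, h'⟩ => ⟨u, mem_eigenspace_iff.2 h', h⟩,
      fun ⟨u, h, h'⟩ => ⟨u, h', mem_eigenspace_iff.1 h⟩⟩
  have h2 := map_eigenspace_Lplus m z
  rw [h1, Module.End.hasEigenvalue_iff, not_iff_not]
  constructor <;> intro h <;> rw [h, Submodule.map_bot] at h2
  · exact Submodule.map_injective_of_injective (ratSpan m).injective_subtype
      (h2.symm.trans (Submodule.map_bot _).symm)
  · exact Submodule.map_injective_of_injective H1.injective_subtype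
      (h2.trans (Submodule.map_bot _).symm)

/-- Simplicity, as for Jacobi matrices: the coefficients of an eigenvector obey a three-term
recurrence, so the one at index -m determines all the others. -/
theorem eq_zero_of_inner_eq_zero {m : ℕ} {u : H1} {z : ℂ} (hu : lplus m u = z • (u : L2))
    (h0 : inner ℂ (ratBasis (-m)) (u : L2) = 0) : u = 0 := by
  have hrec (n : ℤ) := lplus_symmetric m ⟨ratBasis n, ratBasis_mem_H1 n⟩ u
  simp only [lplus_ratBasis, hu, inner_smul_left, inner_smul_right, inner_sub_left] at hrec
  -- The weighted second clause starts the induction: at i = 0 the index -m - 1 lies outside the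
  -- span, but its weight m - |-m| is zero.
  have key (i : ℕ) : i < 2 * m → inner ℂ (ratBasis (-m + i)) (u : L2) = 0 ∧
      ((m : ℂ) - (|-m + i| : ℤ)) * inner ℂ (ratBasis (-m + i - 1)) (u : L2) = 0 := by
    induction i with
    | zero =>
      intro _
      simp [h0]
    | succ i ih =>
      intro hi
      obtain ⟨h1, h2⟩ := ih (by omega)
      have h3 := hrec (-m + i)
      have e : -(m : ℤ) + ((i + 1 : ℕ) : ℤ) = -m + i + 1 := by push_cast; ring
      rw [e, add_sub_cancel_right, h1, mul_zero]
      refine ⟨?_, rfl⟩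
      rw [h1] at h3
      simp only [map_sub, map_natCast, map_intCast] at h3
      have h4 : ((m : ℂ) - (|-m + i + 1| : ℤ)) * inner ℂ (ratBasis (-m + i + 1)) (u : L2) = 0 := by
        have h5 : conj (1 / 2 : ℂ) = 1 / 2 := by simp [map_ofNat]
        rw [h5] at h3
        linear_combination 2 * h3 - h2
      refine (mul_eq_zero.1 h4).resolve_left fun h5 => ?_
      -- Interior edges have nonzero weight, so the recurrence can be solved for the next
      -- coefficient.
      have h6 : |-(m : ℤ) + i + 1| < m := abs_lt.2 ⟨by omega, by omega⟩
      rw [sub_eq_zero, ← Int.cast_natCast, Int.cast_inj] at h5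
      omega
  have hort : ratSpan m ≤ (Submodule.span ℂ {(u : L2)})ᗮ := by
    rw [ratSpan, Submodule.span_le]
    rintro _ ⟨n, hn, rfl⟩
    rw [SetLike.mem_coe, Submodule.mem_orthogonal_singleton_iff_inner_left]
    have h := (key (n + m).toNat (by have := hn.1; have := hn.2; omega)).1
    have e : -(m : ℤ) + ((n + m).toNat : ℤ) = n := by have := hn.1; omega
    rwa [e] at h
  have h := hort (mem_ratSpan_of_lplus_eq hu)
  rw [Submodule.mem_orthogonal_singleton_iff_inner_left, inner_self_eq_zero] at h
  exact Subtype.ext h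

theorem finrank_eigenspace_Lplus_le (m : ℕ) (z : ℂ) :
    Module.finrank ℂ (eigenspace (Lplus m) z) ≤ 1 := by
  rw [Lplus_eq]
  let φ : eigenspace ⟨H1, lplus m⟩ z →ₗ[ℂ] ℂ :=
    (innerSL ℂ (ratBasis (-m)) : L2 →ₗ[ℂ] ℂ) ∘ₗ H1.subtype ∘ₗ (eigenspace ⟨H1, lplus m⟩ z).subtype
  have hφ : Function.Injective φ := by
    refine (injective_iff_map_eq_zero φ).2 fun u hu => Subtype.ext ?_
    exact eq_zero_of_inner_eq_zero (mem_eigenspace_iff.1 u.2) hu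
  simpa using LinearMap.finrank_le_finrank_of_injective hφ

/-- The quadratic form of R is a positive multiple of a sum of squares of inner products. -/
theorem hasEigenvalue_lplusSpan_nonpos {m : ℕ} {E : ℝ}
    (h : Module.End.HasEigenvalue (lplusSpan m) (E : ℂ)) : E ≤ 0 := by
  obtain ⟨u, hu⟩ := h.exists_hasEigenvector
  have h1 := congrArg (fun v : ratSpan m => inner ℂ (u : L2) (v : L2)) hu.apply_eq_smul
  simp only [coe_lplusSpan, opR_eq_sum, inner_neg_right, inner_smul_right, inner_sum,
    Submodule.coe_smul, inner_self_eq_norm_sq_to_K] at h1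
  have h2 (d : ℤ) : inner ℂ (weightVec d) (u : L2) * inner ℂ (u : L2) (weightVec d) =
      ((‖inner ℂ (weightVec d) (u : L2)‖ ^ 2 : ℝ) : ℂ) := by
    rw [← inner_conj_symm (u : L2), Complex.mul_conj']
    push_cast
    rfl
  simp only [h2] at h1
  have h3 : -(2 / Real.pi * ∑ j ∈ Finset.range m, ∑ k ∈ Finset.range m,
      ‖inner ℂ (weightVec ((j : ℤ) - k)) (u : L2)‖ ^ 2) = E * ‖(u : L2)‖ ^ 2 := by
    refine Complex.ofReal_injective ?_
    push_cast at h1 ⊢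
    exact h1
  have h4 : 0 < ‖(u : L2)‖ := norm_pos_iff.2 fun h => hu.2 (Subtype.ext h)
  by_contra! h5
  have h6 : 0 < E * ‖(u : L2)‖ ^ 2 := by positivity
  have h7 : 0 ≤ 2 / Real.pi * ∑ j ∈ Finset.range m, ∑ k ∈ Finset.range m,
      ‖inner ℂ (weightVec ((j : ℤ) - k)) (u : L2)‖ ^ 2 := by positivity
  linarith

theorem hasEigenvalue_lplusSpan_zero {m : ℕ} (hm : 1 ≤ m) :
    Module.End.HasEigenvalue (lplusSpan m) 0 := by
  rw [← mem_pointSpectrum_Lplus_iff, Lplus_eq, mem_pointSpectrum_iff]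
  -- Constant coefficients are in the kernel of the path Laplacian: the image telescopes to boundary
  -- terms, whose weights m - |±m| vanish.
  refine ⟨∑ i ∈ Finset.range (2 * m), ⟨ratBasis (i - m), ratBasis_mem_H1 _⟩, fun h => ?_, ?_⟩
  · have h1 := congrArg (fun v : H1 => inner ℂ (ratBasis (-m)) (v : L2)) h
    simp only [Submodule.coe_sum, inner_sum, inner_ratBasis, Submodule.coe_zero,
      inner_zero_right] at h1
    rw [Finset.sum_eq_single 0] at h1
    · simp [Real.pi_ne_zero] at h1
    · intro i _ hi
      rw [if_neg (by omega)]
    · intro h2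
      exact absurd (Finset.mem_range.2 (by omega)) h2
  · rw [zero_smul, map_sum]
    simp only [lplus_ratBasis, ← Finset.smul_sum]
    have h1 := Finset.sum_range_sub (fun i : ℕ => ((m : ℂ) - (|(i : ℤ) - m| : ℤ)) •
      (ratBasis (i - m) - ratBasis (i - m - 1))) (2 * m)
    have e (i : ℕ) : (((i + 1 : ℕ) : ℤ) - m) = i - m + 1 := by push_cast; ring
    simp only [e, add_sub_cancel_right] at h1
    rw [h1]
    have e1 : |((2 * m : ℕ) : ℤ) - m| = m := by
      push_cast
      rw [two_mul, add_sub_cancel_right, abs_of_nonneg (by positivity)]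
    have e2 : |((0 : ℕ) : ℤ) - m| = m := by simp
    rw [e1, e2]
    simp

theorem exists_eigenvalues_Lplus {m : ℕ} (hm : 1 ≤ m) :
    ∃ E : Fin (2 * m) → ℝ, StrictMono E ∧ (∀ h : 2 * m - 1 < 2 * m, E ⟨2 * m - 1, h⟩ = 0) ∧
      pointSpectrum (Lplus m) = Set.range (fun k => (E k : ℂ)) ∧
      ∀ k, Module.finrank ℂ (eigenspace (Lplus m) (E k : ℂ)) = 1 := by
  have hT := lplusSpan_isSymmetric m
  have hn := finrank_ratSpan m
  -- The eigenvalues of a symmetric map are listed in decreasing order; `Fin.rev` makes the list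
  -- increasing.
  set E : Fin (2 * m) → ℝ := fun k => hT.eigenvalues hn k.rev with hE
  have hev (k : Fin (2 * m)) : Module.End.HasEigenvalue (lplusSpan m) (E k : ℂ) :=
    hT.hasEigenvalue_eigenvalues hn k.rev
  have hmono : Monotone E := fun i j hij => hT.eigenvalues_antitone hn (Fin.rev_le_rev.2 hij)
  have hrange : pointSpectrum (Lplus m) = Set.range (fun k => (E k : ℂ)) := by
    ext z
    rw [mem_pointSpectrum_Lplus_iff]
    constructor
    · intro h
      obtain ⟨i, hi⟩ := hT.exists_eigenvalues_eq hn h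
      refine ⟨i.rev, ?_⟩
      simp only [hE, Fin.rev_rev]
      exact hi
    · rintro ⟨k, rfl⟩
      exact hev k
  have hinj : Function.Injective E := by
    intro i j hij
    -- A repeated value in the list would give an eigenspace of dimension at least 2.
    have h1 := hT.card_filter_eigenvalues_eq hn (E i : ℂ)
    rw [← finrank_eigenspace_Lplus] at h1
    have h2 := Finset.card_le_one.1 (h1.trans_le (finrank_eigenspace_Lplus_le m _)) i.rev
      (by simp [hE]) j.rev (by simpa [hE] using hij.symm)
    exact Fin.rev_injective h2
  refine ⟨E, hmono.strictMono_of_injective hinj, fun h => ?_, hrange, fun k => ?_⟩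
  · refine le_antisymm (hasEigenvalue_lplusSpan_nonpos (hev _)) ?_
    have h0 := hasEigenvalue_lplusSpan_zero hm
    rw [← mem_pointSpectrum_Lplus_iff, hrange] at h0
    obtain ⟨k, hk⟩ := h0
    have hk' : E k = 0 := Complex.ofReal_eq_zero.1 hk
    rw [← hk']
    refine hmono (Fin.mk_le_mk.2 ?_ : k ≤ ⟨2 * m - 1, h⟩)
    omega
  · refine le_antisymm (finrank_eigenspace_Lplus_le m _) ?_
    rw [finrank_eigenspace_Lplus]
    exact Module.finrank_pos_iff.2 (Submodule.nontrivial_iff_ne_bot.2 (hev k))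

/-! ### Relative compactness of the potential -/

namespace IsFourierPair

variable {κ : ℝ → ℂ} {q : ℝ →ᵇ ℂ}

theorem conv_eq_inner (h : IsFourierPair κ q) (f : L2) (ξ : ℝ) :
    ∫ η, κ (ξ - η) * f η = inner ℂ ((h.memLp_reflect ξ).toLp _ : L2) f := by
  rw [L2.inner_def]
  refine integral_congr_ae ?_
  filter_upwards [(h.memLp_reflect ξ).coeFn_toLp] with η hη
  rw [hη, RCLike.inner_apply, Complex.conj_conj, mul_comm]

theorem norm_conv_le (h : IsFourierPair κ q) (f : L2) (ξ : ℝ) :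
    ‖∫ η, κ (ξ - η) * f η‖ ≤ ‖(h.memLp.toLp κ : L2)‖ * ‖f‖ := by
  rw [h.conv_eq_inner]
  refine (norm_inner_le_norm _ _).trans (le_of_eq ?_)
  congr 1
  rw [Lp.norm_toLp, Lp.norm_toLp, ← eLpNorm_comp_measurePreserving h.memLp.aestronglyMeasurable
    (Measure.measurePreserving_sub_left volume ξ)]
  congr 1
  refine eLpNorm_congr_norm_ae (Eventually.of_forall fun η => ?_)
  simp

end IsFourierPair

/-- Compactness of 1/(x + i) from H¹ to L², seen in frequencies. At almost every ξ the transform is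
the pairing of u_n with a fixed vector, so it tends to 0 by weak convergence; dominated convergence
then gives norm convergence. -/
theorem tendsto_mulL2_invAddI {u : ℕ → L2} {v : ℕ → L2} (hv : ∀ n, HasD (u n) (v n)) {C : ℝ}
    (hu : ∀ n, ‖u n‖ ≤ C) (hvC : ∀ n, ‖v n‖ ≤ C)
    (hw : ∀ f : L2, Tendsto (fun n => inner ℂ f (u n)) atTop (𝓝 0)) :
    Tendsto (fun n => mulL2 invAddI (u n)) atTop (𝓝 0) := by
  have h := isFourierPair_expKernel
  have h₁ := isFourierPair_mul_expKernel
  set M₀ := ‖(h.memLp.toLp expKernel : L2)‖ with hM₀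
  set M₁ := ‖(h₁.memLp.toLp _ : L2)‖ with hM₁
  have hC : 0 ≤ C := (norm_nonneg _).trans (hu 0)
  have e1 : ∀ᵐ ξ : ℝ, ∀ n, (𝓕 (mulL2 invAddI (u n)) : L2) ξ =
      ∫ η, expKernel (ξ - η) * (𝓕 (u n) : L2) η :=
    ae_all_iff.2 fun n => h.fourier_mulL2 (u n)
  have e2 : ∀ᵐ ξ : ℝ, ∀ n, ((2 * Real.pi * ξ : ℝ) : ℂ) * (𝓕 (mulL2 invAddI (u n)) : L2) ξ =
      (∫ η, expKernel (ξ - η) * (𝓕 (v n) : L2) η) +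
        ∫ η, (((2 * Real.pi * (ξ - η) : ℝ) : ℂ) * expKernel (ξ - η)) * (𝓕 (u n) : L2) η :=
    ae_all_iff.2 fun n => by
      filter_upwards [h.hasD_mulL2 h₁ (hv n), h.fourier_mulL2 (v n), h₁.fourier_mulL2 (u n),
        coeFn_fourier_add (mulL2 invAddI (v n)) (mulL2 (Complex.I • (invAddI * invAddI)) (u n))]
        with ξ a1 a2 a3 a4
      rw [← a1, a4, a2, a3]
  set M := M₀ * C + (M₀ * C + M₁ * C) with hM
  -- The bounds on u_n and D u_n control the transform and ξ times the transform uniformly, which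
  -- yields an integrable majorant for the square.
  have hbound : ∀ᵐ ξ : ℝ, ∀ n, ‖(𝓕 (mulL2 invAddI (u n)) : L2) ξ‖ ^ 2 ≤ M ^ 2 * (1 + ξ ^ 2)⁻¹ := by
    filter_upwards [e1, e2] with ξ h1 h2 n
    have b1 : ‖(𝓕 (mulL2 invAddI (u n)) : L2) ξ‖ ≤ M₀ * C := by
      rw [h1]
      refine (h.norm_conv_le _ ξ).trans ?_
      rw [Lp.norm_fourier_eq]
      exact mul_le_mul_of_nonneg_left (hu n) (norm_nonneg _)
    have b2 : |ξ| * ‖(𝓕 (mulL2 invAddI (u n)) : L2) ξ‖ ≤ M₀ * C + M₁ * C := by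
      have b3 := congrArg norm (h2 n)
      rw [norm_mul, Complex.norm_real, Real.norm_eq_abs, abs_mul,
        abs_of_pos (by positivity : 0 < 2 * Real.pi)] at b3
      have b4 : ‖∫ η, expKernel (ξ - η) * (𝓕 (v n) : L2) η‖ ≤ M₀ * C := by
        refine (h.norm_conv_le _ ξ).trans ?_
        rw [Lp.norm_fourier_eq]
        exact mul_le_mul_of_nonneg_left (hvC n) (norm_nonneg _)
      have b5 : ‖∫ η, (((2 * Real.pi * (ξ - η) : ℝ) : ℂ) * expKernel (ξ - η)) *
          (𝓕 (u n) : L2) η‖ ≤ M₁ * C := by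
        refine (h₁.norm_conv_le _ ξ).trans ?_
        rw [Lp.norm_fourier_eq]
        exact mul_le_mul_of_nonneg_left (hu n) (norm_nonneg _)
      have b6 := (norm_add_le _ _).trans (add_le_add b4 b5)
      rw [← b3] at b6
      refine le_trans (mul_le_mul_of_nonneg_right ?_ (norm_nonneg _)) b6
      nlinarith [abs_nonneg ξ, Real.pi_gt_three]
    have b7 : (1 + |ξ|) * ‖(𝓕 (mulL2 invAddI (u n)) : L2) ξ‖ ≤ M := by
      rw [hM]
      linarith
    rw [← div_eq_mul_inv, le_div_iff₀ (by positivity)]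
    calc _ ≤ ‖(𝓕 (mulL2 invAddI (u n)) : L2) ξ‖ ^ 2 * (1 + |ξ|) ^ 2 := by
          refine mul_le_mul_of_nonneg_left ?_ (sq_nonneg _)
          nlinarith [abs_nonneg ξ, sq_abs ξ]
      _ = ((1 + |ξ|) * ‖(𝓕 (mulL2 invAddI (u n)) : L2) ξ‖) ^ 2 := by ring
      _ ≤ M ^ 2 := pow_le_pow_left₀ (by positivity) b7 2
  have hlim : ∀ᵐ ξ : ℝ, Tendsto (fun n => ‖(𝓕 (mulL2 invAddI (u n)) : L2) ξ‖ ^ 2) atTop (𝓝 0) := by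
    filter_upwards [e1] with ξ h1
    have h2 (n : ℕ) : (𝓕 (mulL2 invAddI (u n)) : L2) ξ =
        inner ℂ (𝓕⁻ ((h.memLp_reflect ξ).toLp _ : L2) : L2) (u n) := by
      rw [h1, h.conv_eq_inner, ← Lp.inner_fourier_eq (𝓕⁻ _ : L2), fourier_fourierInv_eq]
    simp only [h2]
    simpa using ((hw (𝓕⁻ ((h.memLp_reflect ξ).toLp _ : L2))).norm).pow 2
  have hint := tendsto_integral_of_dominated_convergence (fun ξ : ℝ => M ^ 2 * (1 + ξ ^ 2)⁻¹)
    (fun n => ((Lp.aestronglyMeasurable (𝓕 (mulL2 invAddI (u n)) : L2)).norm.pow 2))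
    (integrable_inv_one_add_sq.const_mul _) (fun n => by
      filter_upwards [hbound] with ξ h3
      simpa using h3 n) hlim
  rw [integral_zero] at hint
  have hnorm (n : ℕ) : ∫ ξ, ‖(𝓕 (mulL2 invAddI (u n)) : L2) ξ‖ ^ 2 = ‖mulL2 invAddI (u n)‖ ^ 2 := by
    have h6 := inner_eq_fourier (mulL2 invAddI (u n)) (mulL2 invAddI (u n))
    simp only [Complex.conj_mul'] at h6
    rw [inner_self_eq_norm_sq_to_K] at h6
    have h7 : ∫ ξ, (((‖(𝓕 (mulL2 invAddI (u n)) : L2) ξ‖ ^ 2 : ℝ)) : ℂ) =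
        ((‖mulL2 invAddI (u n)‖ ^ 2 : ℝ) : ℂ) := by
      push_cast
      exact h6.symm
    rw [integral_complex_ofReal] at h7
    exact_mod_cast h7
  rw [tendsto_zero_iff_norm_tendsto_zero]
  have h4 : Tendsto (fun n => ‖mulL2 invAddI (u n)‖ ^ 2) atTop (𝓝 0) := by
    refine hint.congr fun n => ?_
    rw [← hnorm]
    rfl
  have h5 := h4.sqrt
  rw [Real.sqrt_zero] at h5
  exact h5.congr fun n => Real.sqrt_sq (norm_nonneg _)

/-- |∇|u and Du have equal norms, and the weight is 1/(x + i) followed by the bounded factor 1/(x -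
i). -/
theorem tendsto_weightMul {u : ℕ → H1} (hu : ∀ n, ‖(u n : L2)‖ = 1) {C : ℝ}
    (hC : ∀ n, ‖absNabla (u n)‖ ≤ C)
    (hw : ∀ f : L2, Tendsto (fun n => inner ℂ f (u n : L2)) atTop (𝓝 0)) :
    Tendsto (fun n => weightMul (u n : L2)) atTop (𝓝 0) := by
  choose v hv using fun n => exists_hasD (u n)
  have h := tendsto_mulL2_invAddI hv (C := max C 1) (fun n => (hu n).trans_le (le_max_right _ _))
    (fun n => ((norm_absNabla_eq (hv n)).symm.trans_le (hC n)).trans (le_max_left _ _)) hw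
  have h1 := ((mulL2 (star invAddI)).continuous.tendsto 0).comp h
  rw [map_zero] at h1
  refine h1.congr fun n => ?_
  rw [weightMul, mul_comm, mulL2_mul]
  rfl

theorem tendsto_opR (m : ℕ) {u : ℕ → L2}
    (hw : ∀ f : L2, Tendsto (fun n => inner ℂ f (u n)) atTop (𝓝 0)) :
    Tendsto (fun n => opR m (u n)) atTop (𝓝 0) := by
  simp only [opR_eq_sum]
  have h : Tendsto (fun n => (2 / Real.pi : ℂ) • ∑ j ∈ Finset.range m, ∑ k ∈ Finset.range m,
      inner ℂ (weightVec ((j : ℤ) - k)) (u n) • weightVec ((j : ℤ) - k)) atTop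
      (𝓝 ((2 / Real.pi : ℂ) • ∑ j ∈ Finset.range m, ∑ k ∈ Finset.range m,
        (0 : ℂ) • weightVec ((j : ℤ) - k))) :=
    (tendsto_finsetSum _ fun j _ => tendsto_finsetSum _ fun k _ =>
      (hw _).smul_const _).const_smul _
  simpa using h

/-! ### The essential spectrum -/

theorem mem_essentialSpectrum_iff {A : H1 →ₗ[ℂ] L2} {z : ℂ} :
    z ∈ essentialSpectrum ⟨H1, A⟩ ↔ ∃ u : ℕ → H1, (∀ n, ‖(u n : L2)‖ = 1) ∧
      (∀ f : L2, Tendsto (fun n => inner ℂ f (u n : L2)) atTop (𝓝 0)) ∧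
      Tendsto (fun n => A (u n) - z • (u n : L2)) atTop (𝓝 0) := Iff.rfl

theorem essentialSpectrum_Lminus_eq (m : ℕ) :
    essentialSpectrum (Lminus m) = essentialSpectrum (Lplus m) := by
  ext z
  rw [Lminus_eq, Lplus_eq, mem_essentialSpectrum_iff, mem_essentialSpectrum_iff]
  refine exists_congr fun u => and_congr_right fun _ => and_congr_right fun hw => ?_
  have h := tendsto_opR m hw
  constructor <;> intro h1
  · have h2 := h1.sub h
    rw [sub_zero] at h2
    refine h2.congr fun n => ?_
    rw [lminus_apply]
    abel
  · have h2 := h1.add h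
    rw [add_zero] at h2
    refine h2.congr fun n => ?_
    rw [lminus_apply]
    abel

/-- A Weyl sequence for either operator has |∇|u_n bounded, since the other terms are bounded
operators applied to unit vectors. The potential term then tends to 0, so the same sequence serves
both. -/
theorem essentialSpectrum_Lplus_eq (m : ℕ) :
    essentialSpectrum (Lplus m) = essentialSpectrum ⟨H1, absNabla⟩ := by
  ext z
  rw [Lplus_eq, mem_essentialSpectrum_iff, mem_essentialSpectrum_iff]
  refine exists_congr fun u => and_congr_right fun hu => and_congr_right fun hw => ?_
  constructor <;> intro h1
  · obtain ⟨C, hC⟩ := (Metric.isBounded_range_of_tendsto _ h1).exists_norm_le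
    have hb (n : ℕ) : ‖absNabla (u n)‖ ≤ C + (‖(2 * m : ℂ)‖ * ‖weightMul‖ + ‖z‖) := by
      have h2 : absNabla (u n) = (lplus m (u n) - z • (u n : L2)) +
          ((2 * m : ℂ) • weightMul (u n : L2) + z • (u n : L2)) := by
        rw [lplus_apply]
        abel
      rw [h2]
      refine (norm_add_le _ _).trans (add_le_add (hC _ ⟨n, rfl⟩)
        ((norm_add_le _ _).trans (add_le_add ?_ ?_)))
      · rw [norm_smul]
        refine mul_le_mul_of_nonneg_left ?_ (norm_nonneg _)
        have := weightMul.le_opNorm (u n : L2)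
        rwa [hu, mul_one] at this
      · rw [norm_smul, hu, mul_one]
    have h2 := h1.add ((tendsto_weightMul hu hb hw).const_smul (2 * m : ℂ))
    rw [smul_zero, add_zero] at h2
    refine h2.congr fun n => ?_
    rw [lplus_apply]
    abel
  · obtain ⟨C, hC⟩ := (Metric.isBounded_range_of_tendsto _ h1).exists_norm_le
    have hb (n : ℕ) : ‖absNabla (u n)‖ ≤ C + ‖z‖ := by
      have h2 : absNabla (u n) = (absNabla (u n) - z • (u n : L2)) + z • (u n : L2) := by abel
      rw [h2]
      refine (norm_add_le _ _).trans (add_le_add (hC _ ⟨n, rfl⟩) ?_)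
      rw [norm_smul, hu, mul_one]
    have h2 := h1.sub ((tendsto_weightMul hu hb hw).const_smul (2 * m : ℂ))
    rw [smul_zero, sub_zero] at h2
    refine h2.congr fun n => ?_
    rw [lplus_apply]
    abel

/-! ### The essential spectrum of `|∇|` -/

theorem coeFn_fourier_absNabla_sub (u : H1) (z : ℂ) :
    ((𝓕 (absNabla u - z • (u : L2)) : L2) : ℝ → ℂ) =ᵐ[volume]
      fun ξ => (absSymbol ξ - z) * (𝓕 (u : L2) : L2) ξ := by
  rw [sub_eq_add_neg, ← neg_smul]
  filter_upwards [coeFn_fourier_add (absNabla u) ((-z) • (u : L2)), coeFn_fourier_absNabla u,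
    coeFn_fourier_smul (-z) (u : L2)] with ξ h1 h2 h3
  rw [h1, h2, h3]
  ring

/-- The symbol takes values in [0, ∞), so ‖(|∇| - z)u‖ is at least the distance δ from z to [0, ∞)
for unit vectors u. -/
theorem mem_of_mem_essentialSpectrum_absNabla {z : ℂ}
    (hz : z ∈ essentialSpectrum ⟨H1, absNabla⟩) : z ∈ Complex.ofReal '' Set.Ici 0 := by
  obtain ⟨u, hu, -, h⟩ := mem_essentialSpectrum_iff.1 hz
  have hcl : IsClosed (Complex.ofReal '' Set.Ici 0) :=
    Complex.isometry_ofReal.isClosedEmbedding.isClosedMap _ isClosed_Ici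
  have hne : (Complex.ofReal '' Set.Ici 0).Nonempty := ⟨_, 0, Set.mem_Ici.2 le_rfl, rfl⟩
  rw [hcl.mem_iff_infDist_zero hne]
  set δ := Metric.infDist z (Complex.ofReal '' Set.Ici 0) with hδ
  have hle (n : ℕ) : δ ≤ ‖absNabla (u n) - z • (u n : L2)‖ := by
    have h1 : ‖(δ : ℂ) • (𝓕 (u n : L2) : L2)‖ ≤ ‖(𝓕 (absNabla (u n) - z • (u n : L2)) : L2)‖ := by
      refine Lp.norm_le_norm_of_ae_le ?_
      filter_upwards [Lp.coeFn_smul (δ : ℂ) (𝓕 (u n : L2) : L2),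
        coeFn_fourier_absNabla_sub (u n) z] with ξ h2 h3
      rw [h2, h3, Pi.smul_apply, norm_smul, norm_mul, Complex.norm_real,
        Real.norm_of_nonneg Metric.infDist_nonneg]
      refine mul_le_mul_of_nonneg_right ?_ (norm_nonneg _)
      rw [← dist_eq_norm, dist_comm]
      exact Metric.infDist_le_dist_of_mem ⟨_, Set.mem_Ici.2 (by positivity), rfl⟩
    rwa [norm_smul, Lp.norm_fourier_eq, Lp.norm_fourier_eq, hu, mul_one, Complex.norm_real,
      Real.norm_of_nonneg Metric.infDist_nonneg] at h1
  have h0 := h.norm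
  rw [norm_zero] at h0
  exact le_antisymm (ge_of_tendsto' h0 hle) Metric.infDist_nonneg

/-- Disjoint intervals shrinking to `a`. -/
def weylInterval (a : ℝ) (n : ℕ) : Set ℝ := Set.Ioc (a + 1 / (n + 2)) (a + 1 / (n + 1))

theorem volume_weylInterval (a : ℝ) (n : ℕ) :
    (volume : Measure ℝ).real (weylInterval a n) = 1 / ((n + 1) * (n + 2)) := by
  have h : (1 : ℝ) / (n + 2) ≤ 1 / (n + 1) := by gcongr; norm_num
  rw [weylInterval, Real.volume_real_Ioc_of_le (by linarith)]
  field_simp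
  ring

theorem volume_weylInterval_ne_top (a : ℝ) (n : ℕ) :
    (volume : Measure ℝ) (weylInterval a n) ≠ ∞ := by
  rw [weylInterval, Real.volume_Ioc]
  exact ENNReal.ofReal_ne_top

theorem measurableSet_weylInterval (a : ℝ) (n : ℕ) : MeasurableSet (weylInterval a n) :=
  measurableSet_Ioc

/-- Normalized indicator functions of the intervals. -/
def weylIndicator (a : ℝ) (n : ℕ) : L2 :=
  indicatorConstLp 2 (measurableSet_weylInterval a n) (volume_weylInterval_ne_top a n)
    ((Real.sqrt ((n + 1) * (n + 2)) : ℝ) : ℂ)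

theorem coeFn_weylIndicator (a : ℝ) (n : ℕ) : weylIndicator a n =ᵐ[volume]
    (weylInterval a n).indicator fun _ => ((Real.sqrt ((n + 1) * (n + 2)) : ℝ) : ℂ) :=
  indicatorConstLp_coeFn

theorem orthonormal_weylIndicator (a : ℝ) : Orthonormal ℂ (weylIndicator a) := by
  refine ⟨fun n => ?_, fun i j hij => ?_⟩
  · rw [weylIndicator, norm_indicatorConstLp (by norm_num) (by norm_num), volume_weylInterval,
      Complex.norm_real, Real.norm_of_nonneg (Real.sqrt_nonneg _), Real.sqrt_eq_rpow]
    simp only [ENNReal.toReal_ofNat]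
    rw [← Real.mul_rpow (by positivity) (by positivity), mul_one_div_cancel (by positivity),
      Real.one_rpow]
  · have hd : Disjoint (weylInterval a i) (weylInterval a j) := by
      have key : ∀ i j : ℕ, i < j → Disjoint (weylInterval a i) (weylInterval a j) := by
        intro i j hij
        refine Set.disjoint_left.2 fun x h1 h2 => ?_
        have h3 : (1 : ℝ) / (j + 1) ≤ 1 / (i + 2) := by
          have : (i : ℝ) + 1 ≤ j := by exact_mod_cast hij
          exact one_div_le_one_div_of_le (by positivity) (by linarith)
        have h4 := h1.1
        have h5 := h2.2
        linarith
      rcases lt_or_gt_of_ne hij with h | h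
      · exact key i j h
      · exact (key j i h).symm
    change inner ℂ (weylIndicator a i) (weylIndicator a j) = 0
    rw [L2.inner_def]
    refine integral_eq_zero_of_ae ?_
    filter_upwards [coeFn_weylIndicator a i, coeFn_weylIndicator a j] with x h1 h2
    by_cases hx : x ∈ weylInterval a i
    · rw [h2, Set.indicator_of_notMem (Set.disjoint_left.1 hd hx), inner_zero_right]
      rfl
    · rw [h1, Set.indicator_of_notMem hx, inner_zero_left]
      rfl

/-- Bessel's inequality: the coefficients along an orthonormal sequence are square summable. -/
theorem tendsto_inner_weylIndicator (a : ℝ) (f : L2) :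
    Tendsto (fun n => inner ℂ f (weylIndicator a n)) atTop (𝓝 0) := by
  have h := ((orthonormal_weylIndicator a).inner_products_summable f).tendsto_atTop_zero.sqrt
  rw [Real.sqrt_zero] at h
  rw [tendsto_zero_iff_norm_tendsto_zero]
  refine h.congr fun n => ?_
  rw [Real.sqrt_sq (norm_nonneg _), norm_inner_symm]

theorem weylIndicator_mem_H1 (a : ℝ) (n : ℕ) : (𝓕⁻ (weylIndicator a n) : L2) ∈ H1 := by
  have h : MemLp (fun ξ => ((2 * Real.pi * ξ : ℝ) : ℂ) * weylIndicator a n ξ) 2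
      (volume : Measure ℝ) := by
    refine MemLp.of_le_mul (c := 2 * Real.pi * (|a| + 1)) (Lp.memLp (weylIndicator a n)) ?_ ?_
    · exact (Continuous.aestronglyMeasurable (by fun_prop)).mul (Lp.aestronglyMeasurable _)
    · filter_upwards [coeFn_weylIndicator a n] with ξ h1
      by_cases hξ : ξ ∈ weylInterval a n
      · rw [norm_mul]
        refine mul_le_mul_of_nonneg_right ?_ (norm_nonneg _)
        rw [Complex.norm_real, Real.norm_eq_abs, abs_mul,
          abs_of_pos (by positivity : 0 < 2 * Real.pi)]
        refine mul_le_mul_of_nonneg_left ?_ (by positivity)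
        have h2 : (1 : ℝ) / (n + 1) ≤ 1 := by
          rw [div_le_one (by positivity)]
          linarith [(Nat.cast_nonneg n : (0 : ℝ) ≤ n)]
        have h3 : (0 : ℝ) < 1 / (n + 2) := by positivity
        rw [abs_le]
        constructor
        · linarith [hξ.1, neg_abs_le a]
        · linarith [hξ.2, le_abs_self a]
      · rw [h1, Set.indicator_of_notMem hξ]
        simp
  have hD : HasD (𝓕⁻ (weylIndicator a n) : L2) (𝓕⁻ (h.toLp _) : L2) := by
    rw [HasD, fourier_fourierInv_eq, fourier_fourierInv_eq]
    exact h.coeFn_toLp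
  exact hD.mem_H1

/-- The Weyl sequence has frequencies concentrating at l/(2π). The intervals approach this point
from the right, so that ξ > 0 and |ξ| = ξ even when l = 0. -/
theorem mem_essentialSpectrum_absNabla {l : ℝ} (hl : 0 ≤ l) :
    (l : ℂ) ∈ essentialSpectrum ⟨H1, absNabla⟩ := by
  set a := l / (2 * Real.pi) with ha
  have ha0 : 0 ≤ a := by positivity
  have hla : l = 2 * Real.pi * a := by
    rw [ha]
    field_simp
  refine mem_essentialSpectrum_iff.2 ⟨fun n => ⟨_, weylIndicator_mem_H1 a n⟩, fun n => ?_,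
    fun f => ?_, ?_⟩
  · rw [← Lp.norm_fourier_eq, fourier_fourierInv_eq]
    exact (orthonormal_weylIndicator a).1 n
  · refine (tendsto_inner_weylIndicator a (𝓕 f)).congr fun n => ?_
    rw [← Lp.inner_fourier_eq f, fourier_fourierInv_eq]
  · have h0 : Tendsto (fun n : ℕ => 2 * Real.pi * (1 / ((n : ℝ) + 1))) atTop (𝓝 0) := by
      simpa using (tendsto_one_div_add_atTop_nhds_zero_nat (𝕜 := ℝ)).const_mul (2 * Real.pi)
    refine squeeze_zero_norm (fun n => ?_) h0
    rw [← Lp.norm_fourier_eq]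
    have h1 : ‖(𝓕 (absNabla ⟨_, weylIndicator_mem_H1 a n⟩ - (l : ℂ) •
        (𝓕⁻ (weylIndicator a n) : L2)) : L2)‖ ≤
        2 * Real.pi * (1 / ((n : ℝ) + 1)) * ‖weylIndicator a n‖ := by
      refine Lp.norm_le_mul_norm_of_ae_le_mul ?_
      have h2 := coeFn_fourier_absNabla_sub ⟨_, weylIndicator_mem_H1 a n⟩ l
      simp only [fourier_fourierInv_eq] at h2
      filter_upwards [h2, coeFn_weylIndicator a n] with ξ h3 h4
      rw [h3, norm_mul]
      by_cases hξ : ξ ∈ weylInterval a n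
      · refine mul_le_mul_of_nonneg_right ?_ (norm_nonneg _)
        have h5 : (0 : ℝ) < 1 / (n + 2) := by positivity
        have h6 : 0 < ξ := by linarith [hξ.1]
        rw [absSymbol, ← Complex.ofReal_sub, Complex.norm_real, abs_of_pos h6, hla, ← mul_sub,
          norm_mul, Real.norm_of_nonneg (by positivity : 0 ≤ 2 * Real.pi)]
        refine mul_le_mul_of_nonneg_left ?_ (by positivity)
        rw [Real.norm_of_nonneg (by linarith [hξ.1])]
        linarith [hξ.2]
      · rw [h4, Set.indicator_of_notMem hξ]
        simp
    rwa [(orthonormal_weylIndicator a).1 n, mul_one] at h1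

theorem essentialSpectrum_absNabla :
    essentialSpectrum ⟨H1, absNabla⟩ = Complex.ofReal '' Set.Ici 0 := by
  refine Set.Subset.antisymm (fun z hz => mem_of_mem_essentialSpectrum_absNabla hz) ?_
  rintro _ ⟨l, hl, rfl⟩
  exact mem_essentialSpectrum_absNabla hl

end HalfWave

end

theorem theorem4 (m : ℕ) (hm : 1 ≤ m) :
    -- the point spectrum of `L₊`
    (∃ E : Fin (2 * m) → ℝ, StrictMono E ∧ E ⟨2 * m - 1, by omega⟩ = 0 ∧
      HalfWave.pointSpectrum (HalfWave.Lplus m) = Set.range (fun k => (E k : ℂ)) ∧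
      ∀ k, Module.finrank ℂ (HalfWave.eigenspace (HalfWave.Lplus m) (E k : ℂ)) = 1) ∧
    -- the point spectrum of `L₋`
    (HalfWave.pointSpectrum (HalfWave.Lminus m) = {0} ∧
      Module.finrank ℂ (HalfWave.eigenspace (HalfWave.Lminus m) 0) = 2 * m) ∧
    -- the essential spectra, and the absence of embedded eigenvalues
    (HalfWave.essentialSpectrum (HalfWave.Lplus m) = Complex.ofReal '' Set.Ici 0 ∧
      HalfWave.essentialSpectrum (HalfWave.Lminus m) = Complex.ofReal '' Set.Ici 0 ∧
      ∀ E : ℝ, 0 < E → (E : ℂ) ∉ HalfWave.pointSpectrum (HalfWave.Lplus m) ∧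
        (E : ℂ) ∉ HalfWave.pointSpectrum (HalfWave.Lminus m)) := by
  have hess : HalfWave.essentialSpectrum (HalfWave.Lplus m) = Complex.ofReal '' Set.Ici 0 := by
    rw [HalfWave.essentialSpectrum_Lplus_eq, HalfWave.essentialSpectrum_absNabla]
  obtain ⟨E, hE, h0, hE'⟩ := HalfWave.exists_eigenvalues_Lplus hm
  refine ⟨⟨E, hE, h0 _, hE'⟩,
    ⟨HalfWave.pointSpectrum_Lminus hm, HalfWave.finrank_eigenspace_Lminus m⟩,
    hess, (HalfWave.essentialSpectrum_Lminus_eq m).trans hess, fun E hE => ⟨fun h => ?_, fun h => ?_⟩⟩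
  · exact hE.not_ge (HalfWave.hasEigenvalue_lplusSpan_nonpos
      (HalfWave.mem_pointSpectrum_Lplus_iff.1 h))
  · rw [HalfWave.pointSpectrum_Lminus hm, Set.mem_singleton_iff, Complex.ofReal_eq_zero] at h
    exact hE.ne' h
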